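/- **Setting.** Let $X$ be a compact metrizable space and $\mathcal P(X)$ the set of all Borel probability measures on $X$ with the weak topology. Let $Y$ be a measurable space with a $\sigma$-finite reference measure $\nu$, and let $r(y\mid x)>0$ be a jointly measurable transition density with $\int r(y\mid x)\,\nu(dy)=1$ for every $x$ and $x\mapsto r(y\mid x)$ continuous for every $y$. For $p\in\mathcal P(X)$ let $\mathcal T_r p$ be the probability measure on $Y$ with $\nu$-density $\mathcal T_rp(y)=\int r(y\mid x)\,p(dx)$. Let $p_{\rm data},h\in\mathcal P(X)$, $q=\mathcal T_r p_{\rm data}$, and assume that $h$ has full support (it charges every nonempty open set) and that $\mathrm{KL}(q\,\|\,\mathcal T_r h)<\infty$. For $\lambda\ge 0$ put $\mathcal J_\lambda(p)=\mathrm{KL}(q\,\|\,\mathcal T_rp)+\lambda\,\mathrm{KL}(h\,\|\,p)$ for $p\in\mathcal P(X)$, and let $\mathcal S(q)=\{p\in\mathcal P(X):\mathcal T_rp=q\}$. Given $\gamma\in(0,1]$, $\lambda\ge0$ and an arbitrary $p^0\in\mathcal P(X)$, the (online) SFBD-OMNI iteration is $$u_y^k(dx)=\frac{r(y\mid x)}{\mathcal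 T_rp^k(y)}\,p^k(dx),\qquad \tilde p^0=\int u_y^0\,q(dy),\qquad \tilde p^{k+1}=\gamma\int u_y^k\,q(dy)+(1-\gamma)\,\tilde p^k,$$ $$p^{k+1}=\frac1{1+\lambda}\,\tilde p^{k+1}+\frac{\lambda}{1+\lambda}\,h .$$ Write $p^k_\lambda$ for $p^k$ when the dependence on $\lambda$ matters. **Proposition (Convergence to the optimum).** 1. For every $\lambda>0$ the functional $\mathcal J_\lambda$ attains its minimum over $\mathcal P(X)$, and a minimizer that is absolutely continuous with respect to $h$ is the only minimizer. Whenever the minimizer $p^*_\lambda=\operatorname{argmin}_{p\in\mathcal P(X)}\mathcal J_\lambda(p)$ is unique, $p^k\to p^*_\lambda$ weakly as $k\to\infty$. 2. $\mathrm{KL}(h\,\|\,\cdot)$ attains its minimum over $\mathcal S(q)$, and a minimizer that is absolutely continuous with respect to $h$ and has a finite value is the only one. Whenever the minimizer $h^\dagger=\operatorname{argmin}_{p\in\mathcal S(q)}\mathrm{KL}(h\,\|\,p)$ is unique, the iterates converge to $h^\dagger$ as first $k\to\infty$ and then $\lambda\to0^+$: for every neighbourhood $U$ of $h^\dagger$ and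 all sufficiently small $\lambda>0$ one has $p^k_\lambda\in U$ for all sufficiently large $k$. Moreover, any choice of minimizers $p_\lambda^*$ of $\mathcal J_\lambda$ converges weakly to $h^\dagger$ as $\lambda\to0^+$. 3. Let $h^\dagger$ be a minimizer of $\mathrm{KL}(h\,\|\,\cdot)$ over $\mathcal S(q)$. For the iteration with $\lambda=0$, $$\mathrm{KL}(h^\dagger\,\|\,p^{k+1})\le \mathrm{KL}(h^\dagger\,\|\,p^{k})\quad(k\ge0),\qquad \min_{1\le k\le K}\mathrm{KL}(q\,\|\,\mathcal T_rp^k)\le\frac{\mathrm{KL}(h^\dagger\,\|\,p^0)}{\gamma K}\quad(K\ge1).$$ If in addition $\mathcal S(q)=\{h^\dagger\}$ and $\mathrm{KL}(h^\dagger\,\|\,p^0)<\infty$, then $p^k\to h^\dagger$ weakly. -/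

import Mathlib

open MeasureTheory InformationTheory Filter Topology
open scoped NNReal ENNReal

namespace SFBD

/-- A corruption process from `X` to `Y` with strictly positive transition density
`r(y | x) = density x y` with respect to the reference measure `ν` on `Y`. -/
structure CorruptionDensity (X Y : Type*) [MeasurableSpace X] [MeasurableSpace Y]
    (ν : Measure Y) where
  density : X → Y → ℝ≥0
  measurable_density : Measurable (Function.uncurry density)
  density_pos : ∀ x y, 0 < density x y
  lintegral_density : ∀ x, ∫⁻ y, (density x y : ℝ≥0∞) ∂ν = 1

section Operators

variable {X Y : Type*} [MeasurableSpace X] [MeasurableSpace Y] {ν : Measure Y}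

/-- The density `y ↦ ∫ r(y | x) p(dx)` of the corrupted distribution. -/
noncomputable def corruptDensity (r : CorruptionDensity X Y ν) (p : ProbabilityMeasure X)
    (y : Y) : ℝ≥0∞ :=
  ∫⁻ x, (r.density x y : ℝ≥0∞) ∂(p : Measure X)

theorem measurable_density_coe (r : CorruptionDensity X Y ν) :
    Measurable (fun z : Y × X => (r.density z.2 z.1 : ℝ≥0∞)) :=
  (r.measurable_density.comp measurable_swap).coe_nnreal_ennreal

theorem measurable_corruptDensity (r : CorruptionDensity X Y ν) (p : ProbabilityMeasure X) :
    Measurable (corruptDensity r p) :=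
  (measurable_density_coe r).lintegral_prod_right'

theorem corruptDensity_ne_zero (r : CorruptionDensity X Y ν) (p : ProbabilityMeasure X) (y : Y) :
    corruptDensity r p y ≠ 0 := by
  have hm : Measurable (fun x => (r.density x y : ℝ≥0∞)) :=
    (measurable_density_coe r).comp measurable_prodMk_left
  intro h0
  have h1 := (lintegral_eq_zero_iff hm).1 h0
  have h2 : ∀ᵐ _ ∂(p : Measure X), False := by
    filter_upwards [h1] with x hx
    exact (r.density_pos x y).ne' (by simpa using hx)
  obtain ⟨x, hx⟩ := h2.exists
  exact hx

theorem lintegral_corruptDensity [SigmaFinite ν] (r : CorruptionDensity X Y ν)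
    (p : ProbabilityMeasure X) : ∫⁻ y, corruptDensity r p y ∂ν = 1 := by
  unfold corruptDensity
  rw [lintegral_lintegral_swap (measurable_density_coe r).aemeasurable]
  simp [r.lintegral_density]

/-- The corruption operator `T_r`: the law of `y` when `x ∼ p` and `y ∼ r(· | x)`. -/
noncomputable def corrupt [SigmaFinite ν] (r : CorruptionDensity X Y ν)
    (p : ProbabilityMeasure X) : ProbabilityMeasure Y :=
  ⟨ν.withDensity (corruptDensity r p),
    ⟨by rw [withDensity_apply _ MeasurableSet.univ, Measure.restrict_univ,
          lintegral_corruptDensity]⟩⟩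

/-- The posterior `u_y(dx) = p(dx) r(y | x) / T_r p (y)`. -/
noncomputable def posterior (r : CorruptionDensity X Y ν) (p : ProbabilityMeasure X) (y : Y) :
    Measure X :=
  (p : Measure X).withDensity (fun x => (r.density x y : ℝ≥0∞) / corruptDensity r p y)

theorem measurable_posterior (r : CorruptionDensity X Y ν) (p : ProbabilityMeasure X) :
    Measurable (posterior r p) := by
  refine Measure.measurable_of_measurable_coe _ fun s hs => ?_
  have h : Measurable (fun z : Y × X =>
      (r.density z.2 z.1 : ℝ≥0∞) / corruptDensity r p z.1) :=
    (measurable_density_coe r).div ((measurable_corruptDensity r p).comp measurable_fst)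
  simp only [posterior, withDensity_apply _ hs]
  exact h.lintegral_prod_right'

theorem posterior_univ (r : CorruptionDensity X Y ν) (p : ProbabilityMeasure X) (y : Y)
    (hy : corruptDensity r p y ≠ ∞) : posterior r p y Set.univ = 1 := by
  have hm : Measurable (fun x => (r.density x y : ℝ≥0∞)) :=
    (measurable_density_coe r).comp measurable_prodMk_left
  rw [posterior, withDensity_apply _ MeasurableSet.univ, Measure.restrict_univ]
  simp only [div_eq_mul_inv]
  rw [lintegral_mul_const _ hm]
  exact ENNReal.mul_inv_cancel (corruptDensity_ne_zero r p y) hy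

/-- The mixture `∫ q(dy) u_y` of the posteriors of `p` over `y ∼ q`, where `q = T_r pdata`. -/
noncomputable def posteriorMixture [SigmaFinite ν] (r : CorruptionDensity X Y ν)
    (pdata p : ProbabilityMeasure X) : ProbabilityMeasure X :=
  ⟨(corrupt r pdata : Measure Y).bind (posterior r p), ⟨by
    rw [Measure.bind_apply MeasurableSet.univ (measurable_posterior r p).aemeasurable]
    have hfin : ∀ᵐ y ∂ν, corruptDensity r p y < ∞ :=
      ae_lt_top (measurable_corruptDensity r p) (by simp [lintegral_corruptDensity])
    have hac : (corrupt r pdata : Measure Y) ≪ ν := withDensity_absolutelyContinuous _ _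
    have h1 : ∀ᵐ y ∂(corrupt r pdata : Measure Y), posterior r p y Set.univ = 1 := by
      filter_upwards [hac.ae_le hfin] with y hy
      exact posterior_univ r p y hy.ne
    rw [lintegral_congr_ae h1]
    simp⟩⟩

/-- The mixture `t μ + (1 - t) μ'` of two probability measures. -/
noncomputable def mix (t : unitInterval) (μ μ' : ProbabilityMeasure X) : ProbabilityMeasure X :=
  ⟨ENNReal.ofReal (t : ℝ) • (μ : Measure X) + ENNReal.ofReal (1 - (t : ℝ)) • (μ' : Measure X),
    ⟨by
      simp only [Measure.coe_add, Measure.coe_smul, Pi.add_apply, Pi.smul_apply, measure_univ,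
        smul_eq_mul, mul_one]
      rw [← ENNReal.ofReal_add t.2.1 (sub_nonneg.2 t.2.2)]
      simp⟩⟩

/-- The weight `1 / (1 + lam)` of the reconstructed distribution; the complementary weight
`1 - 1 / (1 + lam) = lam / (1 + lam)` is the one of the prior. -/
noncomputable def dataWeight (lam : ℝ≥0) : unitInterval :=
  ⟨1 / (1 + (lam : ℝ)), by positivity,
    div_le_one_of_le₀ (by linarith [lam.coe_nonneg]) (by positivity)⟩

/-- The online iteration with regularization `lam` and update ratio `γ`, as the sequence of pairs
`(p^k, p̃^k)`: one has `p̃^0 = ∫ q(dy) u_y^0`,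
`p̃^(k+1) = γ ∫ q(dy) u_y^k + (1 - γ) p̃^k` and
`p^(k+1) = p̃^(k+1) / (1 + lam) + (lam / (1 + lam)) h`,
where `u_y^k` is the posterior of `p^k` and `q = T_r pdata`. -/
noncomputable def iteratePair [SigmaFinite ν] (r : CorruptionDensity X Y ν)
    (pdata h : ProbabilityMeasure X) (γ : unitInterval) (p0 : ProbabilityMeasure X) (lam : ℝ≥0) :
    ℕ → ProbabilityMeasure X × ProbabilityMeasure X
  | 0 => (p0, posteriorMixture r pdata p0)
  | k + 1 =>
    let s := iteratePair r pdata h γ p0 lam k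
    let ptilde := mix γ (posteriorMixture r pdata s.1) s.2
    (mix (dataWeight lam) ptilde h, ptilde)

/-- The iterate `p^k`. -/
noncomputable def iterate [SigmaFinite ν] (r : CorruptionDensity X Y ν)
    (pdata h : ProbabilityMeasure X) (γ : unitInterval) (p0 : ProbabilityMeasure X) (lam : ℝ≥0)
    (k : ℕ) : ProbabilityMeasure X :=
  (iteratePair r pdata h γ p0 lam k).1

/-- The Kullback–Leibler divergence of two probability measures. -/
noncomputable def KL {Z : Type*} [MeasurableSpace Z] (μ μ' : ProbabilityMeasure Z) : ℝ≥0∞ :=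
  klDiv (μ : Measure Z) (μ' : Measure Z)

/-- The objective `J_lam(p) = KL(q ‖ T_r p) + lam KL(h ‖ p)` with `q = T_r pdata`. -/
noncomputable def objective [SigmaFinite ν] (r : CorruptionDensity X Y ν)
    (pdata h : ProbabilityMeasure X) (lam : ℝ≥0) (p : ProbabilityMeasure X) : ℝ≥0∞ :=
  KL (corrupt r pdata) (corrupt r p) + (lam : ℝ≥0∞) * KL h p

/-- The solution set `S(q) = {p : T_r p = q}` with `q = T_r pdata`. -/
def solutionSet [SigmaFinite ν] (r : CorruptionDensity X Y ν) (pdata : ProbabilityMeasure X) :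
    Set (ProbabilityMeasure X) :=
  {p | corrupt r p = corrupt r pdata}

end Operators

/-- `a` is a minimizer of `f` over `s`. -/
def IsMinimizer {P : Type*} (f : P → ℝ≥0∞) (s : Set P) (a : P) : Prop :=
  a ∈ s ∧ ∀ b ∈ s, f a ≤ f b

/-- `a = argmin_s f`: `a` is the one and only minimizer of `f` over `s`. -/
def IsArgmin {P : Type*} (f : P → ℝ≥0∞) (s : Set P) (a : P) : Prop :=
  IsMinimizer f s a ∧ ∀ b, IsMinimizer f s b → b = a

end SFBD

/-! The penalty λ KL(h ‖ p) is absorbed into the channel. Put t = 1/(1+λ) and let an augmented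
channel emit a corrupted sample with probability t and otherwise reveal its input. Against the
target `sumMix t q h` on `Y ⊕ X`, the divergence of the output law of p is t · J_λ(p)
(`klDiv_channel_comp`). The posterior of a revealed point is a Dirac mass, so the posterior mixture
is exactly the undamped regularized step (`channelPosterior_comp`). The iteration is therefore a
damped EM algorithm for one channel, and everything about it follows from the chain rule and data
processing.

The engine is the five-point inequality `klDiv_posterior_comp_add_le`. Convexity of KL carries it
through the damping. Telescoping, together with monotonicity of J_λ along the iterates, shows that
J_λ(p^k) exceeds J_λ(p) by O(1/k) whenever the exact step from p has finite divergence from p^1. For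
λ > 0 the iterate p^1 dominates a multiple of h, so this holds when J_λ(p) is finite and p has
bounded density with respect to h. Such p suffice: the infimum of J_λ is unchanged on them
(`exists_bounded_density_objective_lt`), by smoothing the part of p that exceeds a truncated
density. Full support of h enters there.

The rest is compactness of P(X). J_λ is lower semicontinuous, by Donsker–Varadhan for the penalty
and Fatou for the fit, so a minimizing sequence enters every open set containing all minimizers. As
λ → 0 these minimizers approach the projection of h onto S(q). For λ = 0 the points of S(q) are
fixed by the exact step and can be inserted directly into the telescoped inequality. -/

namespace SFBD
open ProbabilityTheory

/-! ### Kullback–Leibler divergence: disjoint unions, convexity, splitting off a marginal. -/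

section KLGeneral

variable {A B : Type*} [MeasurableSpace A] [MeasurableSpace B]

theorem klDiv_withDensity_left (μ : Measure A) [IsFiniteMeasure μ] {f : A → ℝ≥0∞}
    (hf : Measurable f) (hfi : ∫⁻ x, f x ∂μ ≠ ∞) :
    klDiv (μ.withDensity f) μ = ∫⁻ x, ENNReal.ofReal (klFun (f x).toReal) ∂μ := by
  have : IsFiniteMeasure (μ.withDensity f) := isFiniteMeasure_withDensity hfi
  rw [klDiv_eq_lintegral_klFun_of_ac (withDensity_absolutelyContinuous _ _)]
  refine lintegral_congr_ae ?_
  filter_upwards [Measure.rnDeriv_withDensity μ hf] with x hx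
  rw [hx]

theorem map_inl_add_map_inr_apply (μ : Measure A) (ν : Measure B) (s : Set (A ⊕ B))
    (hs : MeasurableSet s) :
    (μ.map Sum.inl + ν.map Sum.inr : Measure (A ⊕ B)) s = μ (Sum.inl ⁻¹' s) + ν (Sum.inr ⁻¹' s) := by
  rw [Measure.add_apply, Measure.map_apply measurable_inl hs, Measure.map_apply measurable_inr hs]

theorem lintegral_map_inl_add_map_inr (μ : Measure A) (ν : Measure B) {f : A ⊕ B → ℝ≥0∞}
    (hf : Measurable f) :
    ∫⁻ z, f z ∂(μ.map Sum.inl + ν.map Sum.inr)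
      = ∫⁻ a, f (Sum.inl a) ∂μ + ∫⁻ b, f (Sum.inr b) ∂ν := by
  rw [lintegral_add_measure, lintegral_map hf measurable_inl, lintegral_map hf measurable_inr]

/-- The Kullback–Leibler divergence is additive over disjoint unions. -/
theorem klDiv_sum (μ₁ ν₁ : Measure A) (μ₂ ν₂ : Measure B) [IsFiniteMeasure μ₁]
    [IsFiniteMeasure ν₁] [IsFiniteMeasure μ₂] [IsFiniteMeasure ν₂] :
    klDiv (μ₁.map Sum.inl + μ₂.map Sum.inr) (ν₁.map Sum.inl + ν₂.map Sum.inr)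
      = klDiv μ₁ ν₁ + klDiv μ₂ ν₂ := by
  by_cases h1 : μ₁ ≪ ν₁
  swap
  · rw [klDiv_of_not_ac h1, top_add, klDiv_of_not_ac]
    refine fun h => h1 (Measure.AbsolutelyContinuous.mk fun s hs h0 => ?_)
    have hs' : MeasurableSet (Sum.inl '' s : Set (A ⊕ B)) :=
      measurableSet_inl_image.2 hs
    have h2 : (ν₁.map Sum.inl + ν₂.map Sum.inr : Measure (A ⊕ B)) (Sum.inl '' s : Set (A ⊕ B)) = 0 := by
      rw [map_inl_add_map_inr_apply _ _ _ hs', Set.preimage_image_eq _ Sum.inl_injective, h0,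
        Set.preimage_inr_image_inl, measure_empty, zero_add]
    have h3 := h h2
    rw [map_inl_add_map_inr_apply _ _ _ hs', Set.preimage_image_eq _ Sum.inl_injective] at h3
    exact (add_eq_zero.1 h3).1
  by_cases h2 : μ₂ ≪ ν₂
  swap
  · rw [klDiv_of_not_ac h2, add_top, klDiv_of_not_ac]
    refine fun h => h2 (Measure.AbsolutelyContinuous.mk fun s hs h0 => ?_)
    have hs' : MeasurableSet (Sum.inr '' s : Set (A ⊕ B)) :=
      measurableSet_inr_image.2 hs
    have h2 : (ν₁.map Sum.inl + ν₂.map Sum.inr : Measure (A ⊕ B)) (Sum.inr '' s : Set (A ⊕ B)) = 0 := by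
      rw [map_inl_add_map_inr_apply _ _ _ hs', Set.preimage_image_eq _ Sum.inr_injective, h0,
        Set.preimage_inl_image_inr, measure_empty, zero_add]
    have h3 := h h2
    rw [map_inl_add_map_inr_apply _ _ _ hs', Set.preimage_image_eq _ Sum.inr_injective] at h3
    exact (add_eq_zero.1 h3).2
  set f : A ⊕ B → ℝ≥0∞ := Sum.elim (μ₁.rnDeriv ν₁) (μ₂.rnDeriv ν₂) with hf
  have hfm : Measurable f :=
    Measurable.sumElim (Measure.measurable_rnDeriv _ _) (Measure.measurable_rnDeriv _ _)
  have hd : μ₁.map Sum.inl + μ₂.map Sum.inr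
      = (ν₁.map Sum.inl + ν₂.map Sum.inr).withDensity f := by
    ext s hs
    rw [withDensity_apply _ hs, ← lintegral_indicator hs,
      lintegral_map_inl_add_map_inr _ _ (hfm.indicator hs), map_inl_add_map_inr_apply _ _ _ hs]
    congr 1
    · conv_lhs => rw [← Measure.withDensity_rnDeriv_eq _ _ h1]
      rw [withDensity_apply _ (measurable_inl hs), ← lintegral_indicator (measurable_inl hs)]
      rfl
    · conv_lhs => rw [← Measure.withDensity_rnDeriv_eq _ _ h2]
      rw [withDensity_apply _ (measurable_inr hs), ← lintegral_indicator (measurable_inr hs)]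
      rfl
  have hfi : ∫⁻ z, f z ∂(ν₁.map Sum.inl + ν₂.map Sum.inr) ≠ ∞ := by
    rw [← setLIntegral_univ, ← withDensity_apply _ MeasurableSet.univ, ← hd]
    exact measure_ne_top _ _
  rw [hd, klDiv_withDensity_left _ hfm hfi, lintegral_map_inl_add_map_inr _ _ (by fun_prop),
    klDiv_eq_lintegral_klFun_of_ac h1, klDiv_eq_lintegral_klFun_of_ac h2]
  rfl

/-- Joint convexity of the Kullback–Leibler divergence, in its subadditive form. -/
theorem klDiv_add_le (μ₁ ν₁ μ₂ ν₂ : Measure A) [IsFiniteMeasure μ₁]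
    [IsFiniteMeasure ν₁] [IsFiniteMeasure μ₂] [IsFiniteMeasure ν₂] :
    klDiv (μ₁ + μ₂) (ν₁ + ν₂) ≤ klDiv μ₁ ν₁ + klDiv μ₂ ν₂ := by
  -- Folding the two copies of `A` together turns a disjoint union into a sum, so the claim is data
  -- processing applied to `klDiv_sum`.
  have hm : Measurable (Sum.elim id id : A ⊕ A → A) := measurable_id.sumElim measurable_id
  have key : ∀ μ ν : Measure A,
      (μ.map Sum.inl + ν.map Sum.inr).map (Sum.elim id id : A ⊕ A → A) = μ + ν := by
    intro μ ν
    ext s hs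
    rw [Measure.map_apply hm hs, map_inl_add_map_inr_apply _ _ _ (hm hs)]
    rfl
  rw [← key μ₁ μ₂, ← key ν₁ ν₂, ← klDiv_sum]
  exact klDiv_map_le _ _ hm

theorem klDiv_smul_ennreal (μ ν : Measure A) [IsFiniteMeasure μ] [IsFiniteMeasure ν]
    {c : ℝ≥0∞} (hc : c ≠ ∞) : klDiv (c • μ) (c • ν) = c * klDiv μ ν := by
  lift c to ℝ≥0 using hc
  exact klDiv_smul_same c

/-- Absolute continuity with respect to `μ ⊗ₘ κ` passes to the first marginal. -/
theorem absolutelyContinuous_fst_compProd {π : Measure (A × B)} [IsFiniteMeasure π]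
    {μ : Measure A} [IsFiniteMeasure μ] {κ : Kernel A B} [IsMarkovKernel κ]
    (hπ : π ≪ μ ⊗ₘ κ) : π ≪ π.fst ⊗ₘ κ := by
  refine Measure.AbsolutelyContinuous.mk fun s hs h0 => ?_
  rw [Measure.compProd_apply hs,
    lintegral_eq_zero_iff (Kernel.measurable_kernel_prodMk_left hs)] at h0
  -- The points whose fibre of `s` is charged by `κ`. Over `S` the marginal of `π` vanishes by `h0`;
  -- off `S` the set `s` is already null for `μ ⊗ₘ κ`.
  set S : Set A := {x | κ x (Prod.mk x ⁻¹' s) ≠ 0} with hS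
  have hSm : MeasurableSet S :=
    (Kernel.measurable_kernel_prodMk_left hs) (measurableSet_singleton 0).compl
  have h1 : π (Prod.fst ⁻¹' S) = 0 := by
    rw [← Measure.fst_apply hSm]
    exact h0
  have h2 : π (s \ Prod.fst ⁻¹' S) = 0 := by
    refine hπ ?_
    have hm : MeasurableSet (s \ Prod.fst ⁻¹' S) := hs.diff (measurable_fst hSm)
    rw [Measure.compProd_apply hm, lintegral_eq_zero_iff (Kernel.measurable_kernel_prodMk_left hm)]
    refine Eventually.of_forall fun x => ?_
    by_cases hx : x ∈ S
    · have : Prod.mk x ⁻¹' (s \ Prod.fst ⁻¹' S) = ∅ := by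
        ext y; simp [hx]
      simp [this]
    · have h3 : κ x (Prod.mk x ⁻¹' s) = 0 := by simpa [hS] using hx
      exact measure_mono_null (fun y hy => hy.1) h3
  refine measure_mono_null (fun z hz => ?_) (measure_union_null h1 h2)
  by_cases hz' : z.1 ∈ S
  · exact Or.inl hz'
  · exact Or.inr ⟨hz, hz'⟩

/-- A finite measure which is absolutely continuous with respect to `π.fst ⊗ₘ κ` disintegrates
along its first marginal, whatever the measurable spaces. -/
theorem exists_compProd_eq_of_absolutelyContinuous {π : Measure (A × B)} [IsFiniteMeasure π]
    {κ : Kernel A B} [IsMarkovKernel κ] (hπ : π ≪ π.fst ⊗ₘ κ) :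
    ∃ ρ : Kernel A B, IsMarkovKernel ρ ∧ π = π.fst ⊗ₘ ρ := by
  classical
  set f : A → B → ℝ≥0 := fun x y => (π.rnDeriv (π.fst ⊗ₘ κ) (x, y)).toNNReal with hf
  have hfm : Measurable (Function.uncurry fun x y => (f x y : ℝ≥0∞)) :=
    (Measure.measurable_rnDeriv _ _).ennreal_toNNReal.coe_nnreal_ennreal
  set η : Kernel A B := κ.withDensity fun x y => (f x y : ℝ≥0∞) with hη
  have : IsSFiniteKernel η := inferInstance
  have hd : π = π.fst ⊗ₘ η := by
    rw [hη, Measure.compProd_withDensity hfm]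
    conv_lhs => rw [← Measure.withDensity_rnDeriv_eq _ _ hπ]
    refine withDensity_congr_ae ?_
    filter_upwards [Measure.rnDeriv_lt_top π (π.fst ⊗ₘ κ)] with z hz
    exact (ENNReal.coe_toNNReal hz.ne).symm
  have hu : Measurable fun x => η x Set.univ := Kernel.measurable_coe η MeasurableSet.univ
  have h1 : (fun x => η x Set.univ) =ᵐ[π.fst] fun _ => 1 := by
    refine ae_eq_of_forall_setLIntegral_eq_of_sigmaFinite hu measurable_const fun s hs _ => ?_
    rw [← Measure.compProd_apply_prod hs MeasurableSet.univ, ← hd, setLIntegral_one,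
      Measure.fst_apply hs]
    congr 1
    ext; simp
  have hS : MeasurableSet {x | η x Set.univ = 1} := hu (measurableSet_singleton 1)
  -- The density yields a kernel of total mass one only `π.fst`-almost everywhere; on the remaining
  -- null set `κ` is substituted.
  refine ⟨Kernel.piecewise hS η κ, ⟨fun x => ⟨?_⟩⟩, ?_⟩
  · rw [Kernel.piecewise_apply]
    split_ifs with hx
    · exact hx
    · exact measure_univ
  · conv_lhs => rw [hd]
    refine Measure.compProd_congr ?_
    filter_upwards [h1] with x hx
    rw [Kernel.piecewise_apply, if_pos (show x ∈ {x | η x Set.univ = 1} from hx)]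

/-- The Pythagorean identity of the Kullback–Leibler divergence: the marginal can be split off. -/
theorem klDiv_compProd_right_eq_add (π : Measure (A × B)) [IsFiniteMeasure π]
    (μ : Measure A) [IsFiniteMeasure μ] (κ : Kernel A B) [IsMarkovKernel κ] :
    klDiv π (μ ⊗ₘ κ) = klDiv π.fst μ + klDiv π (π.fst ⊗ₘ κ) := by
  by_cases h : π ≪ π.fst ⊗ₘ κ
  · obtain ⟨ρ, hρ, he⟩ := exists_compProd_eq_of_absolutelyContinuous h
    have := klDiv_compProd_eq_add (μ := π.fst) (ν := μ) (κ := ρ) (η := κ)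
    rwa [← he] at this
  · rw [klDiv_of_not_ac h, add_top, klDiv_of_not_ac]
    exact fun h' => h (absolutelyContinuous_fst_compProd h')

end KLGeneral

/-! ### Alternating minimization for a general channel. -/

section AbstractEM

variable {X Z : Type*} [MeasurableSpace X] [MeasurableSpace Z]
  {κ : Kernel X Z} [IsMarkovKernel κ] {q : Measure Z} [IsProbabilityMeasure q]
  {p p' : Measure X} [IsProbabilityMeasure p] [IsProbabilityMeasure p']
  {η η' : Kernel Z X} [IsMarkovKernel η] [IsMarkovKernel η']

theorem klDiv_map_swap {A B : Type*} [MeasurableSpace A] [MeasurableSpace B]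
    (μ ν : Measure (A × B)) [IsFiniteMeasure μ] [IsFiniteMeasure ν] :
    klDiv (μ.map Prod.swap) (ν.map Prod.swap) = klDiv μ ν := by
  refine le_antisymm (klDiv_map_le _ _ measurable_swap) ?_
  have h : ∀ ρ : Measure (A × B), (ρ.map Prod.swap).map Prod.swap = ρ := fun ρ => by
    rw [Measure.map_map measurable_swap measurable_swap, Prod.swap_swap_eq, Measure.map_id]
  conv_lhs => rw [← h μ, ← h ν]
  exact klDiv_map_le _ _ measurable_swap

/-- The divergence of the `q`-averaged posterior joint law from the joint law of a prior `m`
through the channel `κ`, split along the prior. -/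
theorem klDiv_posterior_joint (q : Measure Z) [IsProbabilityMeasure q] (η : Kernel Z X)
    [IsMarkovKernel η] (κ : Kernel X Z) [IsMarkovKernel κ]
    (m : Measure X) [IsProbabilityMeasure m] :
    klDiv (q ⊗ₘ η) ((m ⊗ₘ κ).map Prod.swap)
      = klDiv (η ∘ₘ q) m + klDiv (q ⊗ₘ η) (((η ∘ₘ q) ⊗ₘ κ).map Prod.swap) := by
  have h1 : ∀ m : Measure X, IsProbabilityMeasure m → klDiv (q ⊗ₘ η) ((m ⊗ₘ κ).map Prod.swap)
      = klDiv ((q ⊗ₘ η).map Prod.swap) (m ⊗ₘ κ) := fun m _ => by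
    rw [← klDiv_map_swap (q ⊗ₘ η), Measure.map_map measurable_swap measurable_swap,
      Prod.swap_swap_eq, Measure.map_id]
  have h2 : ((q ⊗ₘ η).map Prod.swap).fst = η ∘ₘ q := by
    rw [Measure.fst_map_swap, Measure.snd_compProd]
  rw [h1 _ inferInstance, h1 _ inferInstance, klDiv_compProd_right_eq_add, h2]

/-- By Bayes and the chain rule, the right side is the divergence of `q ⊗ₘ η` from the joint law of
`p` through `κ`. Splitting that along the prior leaves the left side plus the nonnegative KL(η ∘ q ‖
p). -/
theorem klDiv_posterior_joint_self_le
    (hη : (κ ∘ₘ p) ⊗ₘ η = (p ⊗ₘ κ).map Prod.swap) :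
    klDiv (q ⊗ₘ η) (((η ∘ₘ q) ⊗ₘ κ).map Prod.swap) ≤ klDiv q (κ ∘ₘ p) := by
  rw [← klDiv_compProd_left (μ := q) (ν := κ ∘ₘ p) (κ := η), hη, klDiv_posterior_joint q η κ p]
  exact le_add_self

/-- The five-point inequality of alternating minimization. -/
theorem klDiv_posterior_comp_add_le
    (hη : (κ ∘ₘ p) ⊗ₘ η = (p ⊗ₘ κ).map Prod.swap)
    (hη' : (κ ∘ₘ p') ⊗ₘ η' = (p' ⊗ₘ κ).map Prod.swap) :
    klDiv (η ∘ₘ q) (η' ∘ₘ q) + klDiv q (κ ∘ₘ p')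
      ≤ klDiv (η ∘ₘ q) p' + klDiv q (κ ∘ₘ p) := by
  -- Both terms merge into one divergence of joint laws. Splitting it along the prior isolates a
  -- residual that no longer involves `p'`, and this residual is bounded by the fit of `p`.
  calc klDiv (η ∘ₘ q) (η' ∘ₘ q) + klDiv q (κ ∘ₘ p')
      ≤ klDiv (q ⊗ₘ η) (q ⊗ₘ η') + klDiv q (κ ∘ₘ p') := by
        gcongr
        rw [← Measure.snd_compProd q η, ← Measure.snd_compProd q η']
        exact klDiv_map_le _ _ measurable_snd
    _ = klDiv (q ⊗ₘ η) ((p' ⊗ₘ κ).map Prod.swap) := by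
        rw [← hη', klDiv_compProd_eq_add (μ := q) (ν := κ ∘ₘ p'), add_comm]
    _ ≤ klDiv (η ∘ₘ q) p' + klDiv q (κ ∘ₘ p) := by
        rw [klDiv_posterior_joint]
        gcongr
        exact klDiv_posterior_joint_self_le hη

/-- One exact step does not increase the divergence. -/
theorem klDiv_comp_posterior_comp_le
    (hη : (κ ∘ₘ p) ⊗ₘ η = (p ⊗ₘ κ).map Prod.swap) :
    klDiv q (κ ∘ₘ (η ∘ₘ q)) ≤ klDiv q (κ ∘ₘ p) := by
  refine le_trans ?_ (klDiv_posterior_joint_self_le (q := q) hη)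
  have h1 : (q ⊗ₘ η).fst = q := Measure.fst_compProd q η
  have h2 : (((η ∘ₘ q) ⊗ₘ κ).map Prod.swap).fst = κ ∘ₘ (η ∘ₘ q) := by
    rw [Measure.fst_map_swap, Measure.snd_compProd]
  calc klDiv q (κ ∘ₘ (η ∘ₘ q))
      = klDiv (q ⊗ₘ η).fst (((η ∘ₘ q) ⊗ₘ κ).map Prod.swap).fst := by rw [h1, h2]
    _ ≤ _ := klDiv_map_le _ _ measurable_fst

/-- The posterior kernel carries the true output law back to `p`, so this is data processing. -/
theorem klDiv_posterior_comp_le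
    (hη : (κ ∘ₘ p) ⊗ₘ η = (p ⊗ₘ κ).map Prod.swap) : klDiv (η ∘ₘ q) p ≤ klDiv q (κ ∘ₘ p) := by
  have h : η ∘ₘ (κ ∘ₘ p) = p := by
    rw [← Measure.snd_compProd, hη, Measure.snd_map_swap, Measure.fst_compProd]
  conv_lhs => rw [← h]
  exact klDiv_comp_right_le _ _ _

end AbstractEM

/-! ### The augmented channel and its posterior. -/

section Channel

variable {X Y : Type*} [MeasurableSpace X] [MeasurableSpace Y] {ν : Measure Y}

theorem ofReal_add_ofReal_one_sub (t : unitInterval) :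
    ENNReal.ofReal (t : ℝ) + ENNReal.ofReal (1 - (t : ℝ)) = 1 := by
  rw [← ENNReal.ofReal_add t.2.1 (sub_nonneg.2 t.2.2)]
  simp

/-- The mixture of a measure on `A` and a measure on `B` on the disjoint union of `A` and `B`. -/
noncomputable def sumMix {A B : Type*} [MeasurableSpace A] [MeasurableSpace B] (t : unitInterval)
    (μ : Measure A) (μ' : Measure B) : Measure (A ⊕ B) :=
  (ENNReal.ofReal (t : ℝ) • μ).map Sum.inl + (ENNReal.ofReal (1 - (t : ℝ)) • μ').map Sum.inr

theorem sumMix_apply {A B : Type*} [MeasurableSpace A] [MeasurableSpace B] (t : unitInterval)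
    (μ : Measure A) (μ' : Measure B) {s : Set (A ⊕ B)} (hs : MeasurableSet s) :
    sumMix t μ μ' s = ENNReal.ofReal (t : ℝ) * μ (Sum.inl ⁻¹' s)
      + ENNReal.ofReal (1 - (t : ℝ)) * μ' (Sum.inr ⁻¹' s) := by
  rw [sumMix, map_inl_add_map_inr_apply _ _ _ hs]
  rfl

theorem lintegral_sumMix {A B : Type*} [MeasurableSpace A] [MeasurableSpace B] (t : unitInterval)
    (μ : Measure A) (μ' : Measure B) {f : A ⊕ B → ℝ≥0∞} (hf : Measurable f) :
    ∫⁻ z, f z ∂(sumMix t μ μ') = ENNReal.ofReal (t : ℝ) * ∫⁻ a, f (Sum.inl a) ∂μ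
      + ENNReal.ofReal (1 - (t : ℝ)) * ∫⁻ b, f (Sum.inr b) ∂μ' := by
  rw [sumMix, lintegral_map_inl_add_map_inr _ _ hf, lintegral_smul_measure,
    lintegral_smul_measure]
  rfl

instance isProbabilityMeasure_sumMix {A B : Type*} [MeasurableSpace A] [MeasurableSpace B]
    (t : unitInterval) (μ : Measure A) (μ' : Measure B) [IsProbabilityMeasure μ]
    [IsProbabilityMeasure μ'] : IsProbabilityMeasure (sumMix t μ μ') :=
  ⟨by simp [sumMix_apply, ofReal_add_ofReal_one_sub]⟩

theorem klDiv_sumMix {A B : Type*} [MeasurableSpace A] [MeasurableSpace B] (t : unitInterval)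
    (μ₁ ν₁ : Measure A) (μ₂ ν₂ : Measure B) [IsFiniteMeasure μ₁] [IsFiniteMeasure ν₁]
    [IsFiniteMeasure μ₂] [IsFiniteMeasure ν₂] :
    klDiv (sumMix t μ₁ μ₂) (sumMix t ν₁ ν₂) = ENNReal.ofReal (t : ℝ) * klDiv μ₁ ν₁
      + ENNReal.ofReal (1 - (t : ℝ)) * klDiv μ₂ ν₂ := by
  have (μ : Measure A) [IsFiniteMeasure μ] : IsFiniteMeasure (ENNReal.ofReal (t : ℝ) • μ) :=
    Measure.smul_finite _ ENNReal.ofReal_ne_top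
  have (μ : Measure B) [IsFiniteMeasure μ] : IsFiniteMeasure (ENNReal.ofReal (1 - (t : ℝ)) • μ) :=
    Measure.smul_finite _ ENNReal.ofReal_ne_top
  rw [sumMix, sumMix, klDiv_sum, klDiv_smul_ennreal _ _ ENNReal.ofReal_ne_top,
    klDiv_smul_ennreal _ _ ENNReal.ofReal_ne_top]

theorem measurable_density_right (r : CorruptionDensity X Y ν) (y : Y) :
    Measurable fun x => (r.density x y : ℝ≥0∞) :=
  (measurable_density_coe r).comp measurable_prodMk_left

theorem measurable_density_uncurry (r : CorruptionDensity X Y ν) :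
    Measurable (Function.uncurry fun x y => (r.density x y : ℝ≥0∞)) :=
  r.measurable_density.coe_nnreal_ennreal

/-- The corruption channel of `r` which, with probability `1 - t`, reveals its input instead. -/
noncomputable def channel [SigmaFinite ν] (r : CorruptionDensity X Y ν) (t : unitInterval) :
    Kernel X (Y ⊕ X) where
  toFun x := sumMix t (ν.withDensity fun y => (r.density x y : ℝ≥0∞)) (Measure.dirac x)
  measurable' := by
    refine Measure.measurable_of_measurable_coe _ fun s hs => ?_
    simp only [sumMix_apply _ _ _ hs, withDensity_apply _ (measurable_inl hs),
      Measure.dirac_apply' _ (measurable_inr hs)]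
    exact ((measurable_density_uncurry r).lintegral_prod_right'.const_mul _).add
      ((measurable_one.indicator (measurable_inr hs)).const_mul _)

instance isMarkovKernel_channel [SigmaFinite ν] (r : CorruptionDensity X Y ν) (t : unitInterval) :
    IsMarkovKernel (channel r t) := by
  refine ⟨fun x => ?_⟩
  have : IsProbabilityMeasure (ν.withDensity fun y => (r.density x y : ℝ≥0∞)) :=
    ⟨by rw [withDensity_apply _ MeasurableSet.univ, Measure.restrict_univ, r.lintegral_density]⟩
  exact isProbabilityMeasure_sumMix t _ _

theorem channel_apply [SigmaFinite ν] (r : CorruptionDensity X Y ν) (t : unitInterval) (x : X)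
    {s : Set (Y ⊕ X)} (hs : MeasurableSet s) :
    channel r t x s = ENNReal.ofReal (t : ℝ) * ∫⁻ y in Sum.inl ⁻¹' s, r.density x y ∂ν
      + ENNReal.ofReal (1 - (t : ℝ)) * (Sum.inr ⁻¹' s).indicator 1 x := by
  change sumMix t _ _ s = _
  rw [sumMix_apply _ _ _ hs, withDensity_apply _ (measurable_inl hs),
    Measure.dirac_apply' _ (measurable_inr hs)]

theorem setLIntegral_channel [SigmaFinite ν] (r : CorruptionDensity X Y ν) (t : unitInterval)
    (p : ProbabilityMeasure X) {s : Set (Y ⊕ X)} (hs : MeasurableSet s) (B : Set X) :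
    ∫⁻ x in B, channel r t x s ∂(p : Measure X)
      = ENNReal.ofReal (t : ℝ) *
          ∫⁻ y in Sum.inl ⁻¹' s, ∫⁻ x in B, r.density x y ∂(p : Measure X) ∂ν
        + ENNReal.ofReal (1 - (t : ℝ)) * (p : Measure X) (Sum.inr ⁻¹' s ∩ B) := by
  simp only [channel_apply _ _ _ hs]
  rw [lintegral_add_left (by
      exact (measurable_density_uncurry r).lintegral_prod_right'.const_mul _),
    lintegral_const_mul _ (by exact (measurable_density_uncurry r).lintegral_prod_right'),
    lintegral_const_mul _ (measurable_one.indicator (measurable_inr hs)),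
    lintegral_lintegral_swap (measurable_density_uncurry r).aemeasurable,
    lintegral_indicator_one (measurable_inr hs), Measure.restrict_apply (measurable_inr hs)]

theorem channel_comp [SigmaFinite ν] (r : CorruptionDensity X Y ν) (t : unitInterval)
    (p : ProbabilityMeasure X) :
    channel r t ∘ₘ (p : Measure X) = sumMix t (corrupt r p : Measure Y) (p : Measure X) := by
  ext s hs
  rw [Measure.bind_apply hs (Kernel.aemeasurable _), ← setLIntegral_univ,
    setLIntegral_channel r t p hs Set.univ, sumMix_apply _ _ _ hs, Set.inter_univ,
    Measure.restrict_univ]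
  change _ = ENNReal.ofReal (t : ℝ) * ν.withDensity (corruptDensity r p) (Sum.inl ⁻¹' s) + _
  rw [withDensity_apply _ (measurable_inl hs)]
  rfl

/-- The posterior kernel of `channel r t` for the prior `p`. -/
noncomputable def channelPosterior (r : CorruptionDensity X Y ν) (p : ProbabilityMeasure X) :
    Kernel (Y ⊕ X) X where
  toFun := Sum.elim (posterior r p) Measure.dirac
  measurable' := (measurable_posterior r p).sumElim Measure.measurable_dirac

theorem isMarkovKernel_channelPosterior (r : CorruptionDensity X Y ν) (p : ProbabilityMeasure X)
    (hp : ∀ y, corruptDensity r p y ≠ ∞) : IsMarkovKernel (channelPosterior r p) := by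
  refine ⟨fun z => ?_⟩
  rcases z with y | x
  · exact ⟨posterior_univ r p y (hp y)⟩
  · exact Measure.dirac.isProbabilityMeasure

theorem posterior_apply_mul (r : CorruptionDensity X Y ν) (p : ProbabilityMeasure X) (y : Y)
    (hy : corruptDensity r p y ≠ ∞) {B : Set X} (hB : MeasurableSet B) :
    corruptDensity r p y * posterior r p y B = ∫⁻ x in B, r.density x y ∂(p : Measure X) := by
  rw [posterior, withDensity_apply _ hB]
  simp only [div_eq_mul_inv]
  rw [lintegral_mul_const _ (measurable_density_right r y), mul_comm, mul_assoc,
    ENNReal.inv_mul_cancel (corruptDensity_ne_zero r p y) hy, mul_one]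

/-- Bayes' formula for `channel r t`. -/
theorem compProd_channelPosterior [SigmaFinite ν] (r : CorruptionDensity X Y ν) (t : unitInterval)
    (p : ProbabilityMeasure X) (hp : ∀ y, corruptDensity r p y ≠ ∞) :
    (channel r t ∘ₘ (p : Measure X)) ⊗ₘ channelPosterior r p
      = ((p : Measure X) ⊗ₘ channel r t).map Prod.swap := by
  have := isMarkovKernel_channelPosterior r p hp
  have : IsProbabilityMeasure (corrupt r p : Measure Y) := (corrupt r p).2
  refine Measure.ext_prod fun {s B} hs hB => ?_
  rw [Measure.compProd_apply_prod hs hB, Measure.map_apply measurable_swap (hs.prod hB),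
    Set.preimage_swap_prod, Measure.compProd_apply_prod hB hs, setLIntegral_channel r t p hs B,
    channel_comp, ← lintegral_indicator hs,
    lintegral_sumMix _ _ _ ((Kernel.measurable_coe _ hB).indicator hs)]
  congr 2
  · change ∫⁻ y, _ ∂(ν.withDensity (corruptDensity r p)) = _
    have h1 : Measurable fun y => posterior r p y B :=
      (Measure.measurable_coe hB).comp (measurable_posterior r p)
    rw [← lintegral_indicator (measurable_inl hs)]
    have h2 : (fun y => s.indicator (fun z => channelPosterior r p z B) (Sum.inl y))
        = (Sum.inl ⁻¹' s).indicator fun y => posterior r p y B := rfl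
    rw [h2, lintegral_withDensity_eq_lintegral_mul _ (measurable_corruptDensity r p)
      (h1.indicator (measurable_inl hs))]
    refine lintegral_congr fun y => ?_
    rw [Pi.mul_apply]
    by_cases hy : y ∈ Sum.inl ⁻¹' s
    · rw [Set.indicator_of_mem hy, Set.indicator_of_mem hy, posterior_apply_mul r p y (hp y) hB]
    · rw [Set.indicator_of_notMem hy, Set.indicator_of_notMem hy, mul_zero]
  · rw [← lintegral_indicator_one ((measurable_inr hs).inter hB)]
    refine lintegral_congr fun x => ?_
    have : channelPosterior r p (Sum.inr x) = Measure.dirac x := rfl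
    by_cases hx : Sum.inr x ∈ s <;> by_cases hx' : x ∈ B <;>
      simp [Set.indicator, hx, hx', this, Measure.dirac_apply' _ hB]

/-- Dirac posteriors reproduce `h` on the revealed summand, so the EM update of the augmented
problem is the regularized update. -/
theorem channelPosterior_comp [SigmaFinite ν] (r : CorruptionDensity X Y ν) (t : unitInterval)
    (pdata h p : ProbabilityMeasure X) :
    channelPosterior r p ∘ₘ sumMix t (corrupt r pdata : Measure Y) (h : Measure X)
      = (mix t (posteriorMixture r pdata p) h : Measure X) := by
  ext s hs
  rw [Measure.bind_apply hs (Kernel.aemeasurable _),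
    lintegral_sumMix _ _ _ (Kernel.measurable_coe _ hs)]
  change _ = ENNReal.ofReal (t : ℝ) * ((corrupt r pdata : Measure Y).bind (posterior r p)) s
    + ENNReal.ofReal (1 - (t : ℝ)) * (h : Measure X) s
  rw [Measure.bind_apply hs (measurable_posterior r p).aemeasurable]
  congr 2
  change ∫⁻ x, Measure.dirac x s ∂(h : Measure X) = _
  simp only [Measure.dirac_apply' _ hs]
  exact lintegral_indicator_one hs

theorem coe_mix (t : unitInterval) (μ μ' : ProbabilityMeasure X) :
    (mix t μ μ' : Measure X)
      = ENNReal.ofReal (t : ℝ) • (μ : Measure X) + ENNReal.ofReal (1 - (t : ℝ)) • (μ' : Measure X) :=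
  rfl

theorem corruptDensity_mix (r : CorruptionDensity X Y ν) (t : unitInterval) (μ μ' : ProbabilityMeasure X) (y : Y) :
    corruptDensity r (mix t μ μ') y = ENNReal.ofReal (t : ℝ) * corruptDensity r μ y
      + ENNReal.ofReal (1 - (t : ℝ)) * corruptDensity r μ' y := by
  simp only [corruptDensity]
  rw [coe_mix, lintegral_add_measure, lintegral_smul_measure, lintegral_smul_measure]
  rfl

end Channel

/-! ### The exact step and the objective. -/

section EM

variable {X Y : Type*} [MeasurableSpace X] [MeasurableSpace Y] {ν : Measure Y} [SigmaFinite ν]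
  (r : CorruptionDensity X Y ν) (pdata h : ProbabilityMeasure X)

theorem mix_self (t : unitInterval) (μ : ProbabilityMeasure X) : mix t μ μ = μ := by
  refine Subtype.ext ?_
  change ENNReal.ofReal (t : ℝ) • (μ : Measure X) + ENNReal.ofReal (1 - (t : ℝ)) • (μ : Measure X)
    = _
  rw [← add_smul, ofReal_add_ofReal_one_sub, one_smul]
  rfl

/-- Joint convexity of the Kullback–Leibler divergence. -/
theorem KL_mix_mix_le (t : unitInterval) (μ₁ μ₂ ν₁ ν₂ : ProbabilityMeasure X) :
    KL (mix t μ₁ μ₂) (mix t ν₁ ν₂)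
      ≤ ENNReal.ofReal (t : ℝ) * KL μ₁ ν₁ + ENNReal.ofReal (1 - (t : ℝ)) * KL μ₂ ν₂ := by
  have (c : ℝ) (μ : Measure X) [IsFiniteMeasure μ] : IsFiniteMeasure (ENNReal.ofReal c • μ) :=
    Measure.smul_finite _ ENNReal.ofReal_ne_top
  simp only [KL]
  rw [coe_mix, coe_mix, ← klDiv_smul_ennreal _ _ ENNReal.ofReal_ne_top,
    ← klDiv_smul_ennreal _ _ ENNReal.ofReal_ne_top]
  exact klDiv_add_le _ _ _ _

theorem KL_mix_right_le (t : unitInterval) (μ ν₁ ν₂ : ProbabilityMeasure X) :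
    KL μ (mix t ν₁ ν₂)
      ≤ ENNReal.ofReal (t : ℝ) * KL μ ν₁ + ENNReal.ofReal (1 - (t : ℝ)) * KL μ ν₂ := by
  conv_lhs => rw [← mix_self t μ]
  exact KL_mix_mix_le t μ μ ν₁ ν₂

theorem KL_eq_zero_iff {μ μ' : ProbabilityMeasure X} : KL μ μ' = 0 ↔ μ = μ' := by
  rw [KL, klDiv_eq_zero_iff]
  exact ⟨fun h => Subtype.ext h, fun h => h ▸ rfl⟩

theorem corrupt_mix (t : unitInterval) (μ μ' : ProbabilityMeasure X) :
    corrupt r (mix t μ μ') = mix t (corrupt r μ) (corrupt r μ') := by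
  refine Subtype.ext ?_
  change ν.withDensity (corruptDensity r (mix t μ μ'))
    = ENNReal.ofReal (t : ℝ) • ν.withDensity (corruptDensity r μ)
      + ENNReal.ofReal (1 - (t : ℝ)) • ν.withDensity (corruptDensity r μ')
  have hm := measurable_corruptDensity r μ
  rw [← withDensity_smul _ hm, ← withDensity_smul _ (measurable_corruptDensity r μ'),
    ← withDensity_add_left (hm.const_smul _)]
  congr 1
  funext y
  exact corruptDensity_mix r t μ μ' y

theorem objective_mix_le (lam : ℝ≥0) (t : unitInterval) (p p' : ProbabilityMeasure X) :
    objective r pdata h lam (mix t p p') ≤ ENNReal.ofReal (t : ℝ) * objective r pdata h lam p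
      + ENNReal.ofReal (1 - (t : ℝ)) * objective r pdata h lam p' := by
  rw [objective, corrupt_mix]
  calc KL (corrupt r pdata) (mix t (corrupt r p) (corrupt r p')) + lam * KL h (mix t p p')
      ≤ (ENNReal.ofReal (t : ℝ) * KL (corrupt r pdata) (corrupt r p)
          + ENNReal.ofReal (1 - (t : ℝ)) * KL (corrupt r pdata) (corrupt r p'))
        + lam * (ENNReal.ofReal (t : ℝ) * KL h p + ENNReal.ofReal (1 - (t : ℝ)) * KL h p') := by
        gcongr
        · exact KL_mix_right_le _ _ _ _
        · exact KL_mix_right_le _ _ _ _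
    _ = _ := by simp only [objective]; ring

/-- The exact step `p ↦ (∫ q(dy) u_y + lam h) / (1 + lam)` of the iteration. -/
noncomputable def exactStep (lam : ℝ≥0) (p : ProbabilityMeasure X) : ProbabilityMeasure X :=
  mix (dataWeight lam) (posteriorMixture r pdata p) h

theorem ofReal_dataWeight_pos (lam : ℝ≥0) :
    ENNReal.ofReal (dataWeight lam : ℝ) ≠ 0 := by
  have : (0 : ℝ) < 1 / (1 + (lam : ℝ)) := by positivity
  simpa [dataWeight] using this

theorem ofReal_one_sub_dataWeight (lam : ℝ≥0) :
    ENNReal.ofReal (1 - (dataWeight lam : ℝ)) = ENNReal.ofReal (dataWeight lam : ℝ) * lam := by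
  have h1 : (1 : ℝ) + lam ≠ 0 := by positivity
  have h2 : 1 - (dataWeight lam : ℝ) = (dataWeight lam : ℝ) * lam := by
    simp only [dataWeight]; field_simp; ring
  rw [h2, ENNReal.ofReal_mul (dataWeight lam).2.1, ENNReal.ofReal_coe_nnreal]

/-- Divergence adds over the two summands with weights t and 1 - t = tλ, so a factor t comes out and
leaves the penalized objective. -/
theorem klDiv_channel_comp (lam : ℝ≥0) (p : ProbabilityMeasure X) :
    klDiv (sumMix (dataWeight lam) (corrupt r pdata : Measure Y) (h : Measure X))
        (channel r (dataWeight lam) ∘ₘ (p : Measure X))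
      = ENNReal.ofReal (dataWeight lam : ℝ) * objective r pdata h lam p := by
  rw [channel_comp, klDiv_sumMix, ofReal_one_sub_dataWeight, objective, KL, KL, mul_add, mul_assoc]

theorem KL_exactStep_add_le (hT : ∀ (p : ProbabilityMeasure X) y, corruptDensity r p y ≠ ∞)
    (lam : ℝ≥0) (p p' : ProbabilityMeasure X) :
    KL (exactStep r pdata h lam p) (exactStep r pdata h lam p')
        + ENNReal.ofReal (dataWeight lam : ℝ) * objective r pdata h lam p'
      ≤ KL (exactStep r pdata h lam p) p'
        + ENNReal.ofReal (dataWeight lam : ℝ) * objective r pdata h lam p := by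
  have := isMarkovKernel_channelPosterior r p (hT p)
  have := isMarkovKernel_channelPosterior r p' (hT p')
  have := klDiv_posterior_comp_add_le
    (q := sumMix (dataWeight lam) (corrupt r pdata : Measure Y) (h : Measure X))
    (compProd_channelPosterior r (dataWeight lam) p (hT p))
    (compProd_channelPosterior r (dataWeight lam) p' (hT p'))
  rwa [channelPosterior_comp, channelPosterior_comp, klDiv_channel_comp, klDiv_channel_comp] at this

theorem objective_exactStep_le (hT : ∀ (p : ProbabilityMeasure X) y, corruptDensity r p y ≠ ∞)
    (lam : ℝ≥0) (p : ProbabilityMeasure X) :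
    objective r pdata h lam (exactStep r pdata h lam p) ≤ objective r pdata h lam p := by
  have := isMarkovKernel_channelPosterior r p (hT p)
  have := klDiv_comp_posterior_comp_le
    (q := sumMix (dataWeight lam) (corrupt r pdata : Measure Y) (h : Measure X))
    (compProd_channelPosterior r (dataWeight lam) p (hT p))
  rw [channelPosterior_comp, klDiv_channel_comp, klDiv_channel_comp] at this
  exact (ENNReal.mul_le_mul_iff_right (ofReal_dataWeight_pos lam) ENNReal.ofReal_ne_top).1 this

theorem KL_exactStep_le (hT : ∀ (p : ProbabilityMeasure X) y, corruptDensity r p y ≠ ∞)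
    (lam : ℝ≥0) (p : ProbabilityMeasure X) :
    KL (exactStep r pdata h lam p) p
      ≤ ENNReal.ofReal (dataWeight lam : ℝ) * objective r pdata h lam p := by
  have := isMarkovKernel_channelPosterior r p (hT p)
  have := klDiv_posterior_comp_le
    (q := sumMix (dataWeight lam) (corrupt r pdata : Measure Y) (h : Measure X))
    (compProd_channelPosterior r (dataWeight lam) p (hT p))
  rwa [channelPosterior_comp, klDiv_channel_comp] at this

end EM

/-! ### The damped recursion and its telescoped estimate. -/

section Iterates

variable {X Y : Type*} [MeasurableSpace X] [MeasurableSpace Y] {ν : Measure Y} [SigmaFinite ν]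
  (r : CorruptionDensity X Y ν) (pdata h : ProbabilityMeasure X) (γ : unitInterval)
  (p0 : ProbabilityMeasure X) (lam : ℝ≥0)

/-- Damping commutes with mixing in the prior. This closes the recursion on p^k alone, without the
auxiliary sequence. -/
theorem mix_mix_left (s t : unitInterval) (μ₁ μ₂ μ : ProbabilityMeasure X) :
    mix t (mix s μ₁ μ₂) μ = mix s (mix t μ₁ μ) (mix t μ₂ μ) := by
  refine Subtype.ext (Measure.ext fun A _ => ?_)
  have hs := ofReal_add_ofReal_one_sub s
  change ENNReal.ofReal (t : ℝ) * (ENNReal.ofReal (s : ℝ) * (μ₁ : Measure X) A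
      + ENNReal.ofReal (1 - (s : ℝ)) * (μ₂ : Measure X) A)
      + ENNReal.ofReal (1 - (t : ℝ)) * (μ : Measure X) A
    = ENNReal.ofReal (s : ℝ) * (ENNReal.ofReal (t : ℝ) * (μ₁ : Measure X) A
      + ENNReal.ofReal (1 - (t : ℝ)) * (μ : Measure X) A)
      + ENNReal.ofReal (1 - (s : ℝ)) * (ENNReal.ofReal (t : ℝ) * (μ₂ : Measure X) A
      + ENNReal.ofReal (1 - (t : ℝ)) * (μ : Measure X) A)
  calc _ = ENNReal.ofReal (t : ℝ) * (ENNReal.ofReal (s : ℝ) * (μ₁ : Measure X) A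
      + ENNReal.ofReal (1 - (s : ℝ)) * (μ₂ : Measure X) A)
      + (ENNReal.ofReal (s : ℝ) + ENNReal.ofReal (1 - (s : ℝ)))
        * (ENNReal.ofReal (1 - (t : ℝ)) * (μ : Measure X) A) := by rw [hs, one_mul]
    _ = _ := by ring

theorem iterate_zero : iterate r pdata h γ p0 lam 0 = p0 := rfl

/-- At index zero both arguments of the damping coincide, so the first step is exact whatever `γ`
is. The arbitrary `p0` need not contain a share of `h`, so the damped recursion holds only from p^1
on. -/
theorem iterate_one : iterate r pdata h γ p0 lam 1 = exactStep r pdata h lam p0 := by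
  change mix (dataWeight lam) (mix γ (posteriorMixture r pdata p0) (posteriorMixture r pdata p0)) h
    = _
  rw [mix_self]
  rfl

theorem iterate_add_two (k : ℕ) :
    iterate r pdata h γ p0 lam (k + 2)
      = mix γ (exactStep r pdata h lam (iterate r pdata h γ p0 lam (k + 1)))
          (iterate r pdata h γ p0 lam (k + 1)) :=
  mix_mix_left γ (dataWeight lam) _ _ _

theorem objective_iterate_le (hT : ∀ (p : ProbabilityMeasure X) y, corruptDensity r p y ≠ ∞)
    (k : ℕ) : objective r pdata h lam (iterate r pdata h γ p0 lam (k + 2))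
      ≤ objective r pdata h lam (iterate r pdata h γ p0 lam (k + 1)) := by
  rw [iterate_add_two]
  refine (objective_mix_le r pdata h lam γ _ _).trans ?_
  grw [objective_exactStep_le r pdata h hT]
  rw [← add_mul, ofReal_add_ofReal_one_sub, one_mul]

theorem antitone_objective_iterate
    (hT : ∀ (p : ProbabilityMeasure X) y, corruptDensity r p y ≠ ∞) :
    Antitone fun k => objective r pdata h lam (iterate r pdata h γ p0 lam (k + 1)) :=
  antitone_nat_of_succ_le (objective_iterate_le r pdata h γ p0 lam hT)

/-- One damped step decreases the divergence from `exactStep p` by the gap of the objective. -/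
theorem KL_exactStep_iterate_add_le
    (hT : ∀ (p : ProbabilityMeasure X) y, corruptDensity r p y ≠ ∞)
    (p : ProbabilityMeasure X) (k : ℕ) :
    KL (exactStep r pdata h lam p) (iterate r pdata h γ p0 lam (k + 2))
        + ENNReal.ofReal (γ : ℝ) * (ENNReal.ofReal (dataWeight lam : ℝ)
          * objective r pdata h lam (iterate r pdata h γ p0 lam (k + 1)))
      ≤ KL (exactStep r pdata h lam p) (iterate r pdata h γ p0 lam (k + 1))
        + ENNReal.ofReal (γ : ℝ) * (ENNReal.ofReal (dataWeight lam : ℝ)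
          * objective r pdata h lam p) := by
  rw [iterate_add_two]
  set a := ENNReal.ofReal (dataWeight lam : ℝ)
  set g := ENNReal.ofReal (γ : ℝ)
  set g' := ENNReal.ofReal (1 - (γ : ℝ))
  set m := iterate r pdata h γ p0 lam (k + 1)
  calc KL (exactStep r pdata h lam p) (mix γ (exactStep r pdata h lam m) m)
        + g * (a * objective r pdata h lam m)
      ≤ (g * KL (exactStep r pdata h lam p) (exactStep r pdata h lam m)
          + g' * KL (exactStep r pdata h lam p) m) + g * (a * objective r pdata h lam m) := by
        gcongr
        exact KL_mix_right_le _ _ _ _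
    _ = g * (KL (exactStep r pdata h lam p) (exactStep r pdata h lam m)
          + a * objective r pdata h lam m) + g' * KL (exactStep r pdata h lam p) m := by ring
    _ ≤ g * (KL (exactStep r pdata h lam p) m + a * objective r pdata h lam p)
          + g' * KL (exactStep r pdata h lam p) m := by
        exact add_le_add_left
          (mul_le_mul_right (KL_exactStep_add_le r pdata h hT lam p m) _) _
    _ = (g + g') * KL (exactStep r pdata h lam p) m + g * (a * objective r pdata h lam p) := by
        ring
    _ = _ := by rw [ofReal_add_ofReal_one_sub, one_mul]

/-- Telescoping of the damped five-point inequality, written without subtraction because the terms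
may be infinite. -/
theorem sum_objective_iterate_le
    (hT : ∀ (p : ProbabilityMeasure X) y, corruptDensity r p y ≠ ∞)
    (p : ProbabilityMeasure X) (K : ℕ) :
    KL (exactStep r pdata h lam p) (iterate r pdata h γ p0 lam (K + 1))
        + ∑ k ∈ Finset.range K, ENNReal.ofReal (γ : ℝ) * (ENNReal.ofReal (dataWeight lam : ℝ)
          * objective r pdata h lam (iterate r pdata h γ p0 lam (k + 1)))
      ≤ KL (exactStep r pdata h lam p) (iterate r pdata h γ p0 lam 1)
        + K * (ENNReal.ofReal (γ : ℝ) * (ENNReal.ofReal (dataWeight lam : ℝ)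
          * objective r pdata h lam p)) := by
  induction K with
  | zero => simp
  | succ K ih =>
    rw [Finset.sum_range_succ]
    have := KL_exactStep_iterate_add_le r pdata h γ p0 lam hT p K
    calc _ = (KL (exactStep r pdata h lam p) (iterate r pdata h γ p0 lam (K + 2))
          + ENNReal.ofReal (γ : ℝ) * (ENNReal.ofReal (dataWeight lam : ℝ)
            * objective r pdata h lam (iterate r pdata h γ p0 lam (K + 1))))
          + ∑ k ∈ Finset.range K, ENNReal.ofReal (γ : ℝ) * (ENNReal.ofReal (dataWeight lam : ℝ)
            * objective r pdata h lam (iterate r pdata h γ p0 lam (k + 1))) := by ring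
      _ ≤ _ := add_le_add_left this _
      _ = (KL (exactStep r pdata h lam p) (iterate r pdata h γ p0 lam (K + 1))
          + ∑ k ∈ Finset.range K, ENNReal.ofReal (γ : ℝ) * (ENNReal.ofReal (dataWeight lam : ℝ)
            * objective r pdata h lam (iterate r pdata h γ p0 lam (k + 1))))
          + ENNReal.ofReal (γ : ℝ) * (ENNReal.ofReal (dataWeight lam : ℝ)
            * objective r pdata h lam p) := by ring
      _ ≤ _ := add_le_add_left ih _
      _ = _ := by push_cast; ring

/-- Along the iteration the objective falls below its value at every `p` from which the first
iterate is at finite divergence. -/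
theorem eventually_objective_iterate_lt
    (hT : ∀ (p : ProbabilityMeasure X) y, corruptDensity r p y ≠ ∞) (hγ : 0 < γ)
    (p : ProbabilityMeasure X)
    (hp : KL (exactStep r pdata h lam p) (iterate r pdata h γ p0 lam 1) ≠ ∞)
    {c : ℝ≥0∞} (hc : objective r pdata h lam p < c) :
    ∀ᶠ k in atTop, objective r pdata h lam (iterate r pdata h γ p0 lam k) < c := by
  set C := KL (exactStep r pdata h lam p) (iterate r pdata h γ p0 lam 1) with hC
  set b := ENNReal.ofReal (γ : ℝ) * ENNReal.ofReal (dataWeight lam : ℝ) with hb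
  have hb0 : b ≠ 0 := mul_ne_zero (by simpa using hγ) (ofReal_dataWeight_pos lam)
  have hbt : b ≠ ∞ := ENNReal.mul_ne_top ENNReal.ofReal_ne_top ENNReal.ofReal_ne_top
  -- Monotonicity makes the K-th value at most each of the first K, so K copies of it fit under the
  -- telescoped sum. Division by K b then gives an excess of C / (b K).
  have hbound : ∀ K : ℕ, K * b * objective r pdata h lam (iterate r pdata h γ p0 lam K)
      ≤ C + K * b * objective r pdata h lam p := by
    intro K
    rcases K with _ | K
    · simp
    have h1 := sum_objective_iterate_le r pdata h γ p0 lam hT p (K + 1)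
    calc _ = ∑ k ∈ Finset.range (K + 1), b *
            objective r pdata h lam (iterate r pdata h γ p0 lam (K + 1)) := by
          simp [mul_assoc]
      _ ≤ ∑ k ∈ Finset.range (K + 1), b *
            objective r pdata h lam (iterate r pdata h γ p0 lam (k + 1)) := by
          refine Finset.sum_le_sum fun k hk => ?_
          gcongr
          exact antitone_objective_iterate r pdata h γ p0 lam hT
            (Nat.lt_succ_iff.1 (Finset.mem_range.1 hk))
      _ ≤ _ := by
          refine le_trans ?_ (h1.trans (le_of_eq ?_))
          · simp only [hb, mul_assoc]
            exact le_add_self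
          · simp only [hb, hC]; ring
  have hlim : Tendsto (fun K : ℕ => C / b * (K : ℝ≥0∞)⁻¹ + objective r pdata h lam p) atTop
      (𝓝 (objective r pdata h lam p)) := by
    have := (ENNReal.Tendsto.const_mul ENNReal.tendsto_inv_nat_nhds_zero
      (Or.inr (ENNReal.div_ne_top hp hb0))).add_const (objective r pdata h lam p)
    simpa using this
  filter_upwards [hlim.eventually_lt_const hc, eventually_gt_atTop 0] with K hK hK0
  refine lt_of_le_of_lt ?_ hK
  have hK0' : (K : ℝ≥0∞) ≠ 0 := by exact_mod_cast hK0.ne'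
  have hKb : (K : ℝ≥0∞) * b ≠ 0 := mul_ne_zero hK0' hb0
  have hKt : (K : ℝ≥0∞) * b ≠ ∞ := ENNReal.mul_ne_top (ENNReal.natCast_ne_top K) hbt
  refine (ENNReal.mul_le_mul_iff_right hKb hKt).1 ((hbound K).trans (le_of_eq ?_))
  rw [mul_add]
  congr 1
  calc C = C * (b * b⁻¹) * (K * (K : ℝ≥0∞)⁻¹) := by
        rw [ENNReal.mul_inv_cancel hb0 hbt, ENNReal.mul_inv_cancel hK0' (ENNReal.natCast_ne_top K),
          mul_one, mul_one]
    _ = _ := by rw [div_eq_mul_inv]; ring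

end Iterates

/-! ### The Donsker–Varadhan formula with bounded test functions. -/

section DonskerVaradhan

variable {A : Type*} [MeasurableSpace A]

/-- Fenchel–Young: t ↦ exp t - 1 is conjugate to `klFun`, with equality at t = log g. It reduces to
exp s ≥ 1 + s at s = t - log g. -/
theorem mul_sub_exp_le_klFun {g : ℝ} (hg : 0 ≤ g) (t : ℝ) :
    g * t - Real.exp t + 1 ≤ klFun g := by
  rw [klFun_apply]
  rcases hg.eq_or_lt with rfl | hg
  · simpa using (Real.exp_pos t).le
  · have h1 := Real.add_one_le_exp (t - Real.log g)
    rw [Real.exp_sub, Real.exp_log hg, le_div_iff₀ hg] at h1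
    nlinarith

theorem integrable_of_abs_le {μ : Measure A} [IsFiniteMeasure μ] {f : A → ℝ} (hf : Measurable f)
    {M : ℝ} (hM : ∀ x, |f x| ≤ M) : Integrable f μ :=
  Integrable.of_bound hf.aestronglyMeasurable M (Eventually.of_forall hM)

theorem integrable_exp_of_abs_le {μ : Measure A} [IsFiniteMeasure μ] {f : A → ℝ}
    (hf : Measurable f) {M : ℝ} (hM : ∀ x, |f x| ≤ M) : Integrable (fun x => Real.exp (f x)) μ :=
  integrable_of_abs_le (M := Real.exp M) hf.exp fun x => by
    rw [Real.abs_exp]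
    exact Real.exp_le_exp.2 ((le_abs_self _).trans (hM x))

theorem integrable_rnDeriv_toReal_mul {μ ν : Measure A} [IsFiniteMeasure μ] [IsFiniteMeasure ν]
    {f : A → ℝ} (hf : Measurable f) {M : ℝ} (hM : ∀ x, |f x| ≤ M) :
    Integrable (fun x => (μ.rnDeriv ν x).toReal * f x) ν :=
  Measure.integrable_toReal_rnDeriv.mul_bdd hf.aestronglyMeasurable (Eventually.of_forall hM)

theorem integral_sub_add_one {ν : Measure A} [IsProbabilityMeasure ν] {u v : A → ℝ}
    (hu : Integrable u ν) (hv : Integrable v ν) :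
    ∫ x, (u x - v x + 1) ∂ν = 1 + ∫ x, u x ∂ν - ∫ x, v x ∂ν := by
  have h : ∫ x, (u x - v x + 1) ∂ν = ∫ x, (u x - v x) ∂ν + ∫ _, (1 : ℝ) ∂ν :=
    integral_add (hu.sub hv) (integrable_const _)
  rw [h, integral_sub hu hv]
  simp
  ring

/-- The easy half of the Donsker–Varadhan formula. -/
theorem le_klDiv_of_abs_le {μ ν : Measure A} [IsProbabilityMeasure μ] [IsProbabilityMeasure ν]
    {f : A → ℝ} (hf : Measurable f) {M : ℝ} (hM : ∀ x, |f x| ≤ M) (hfin : klDiv μ ν ≠ ∞) :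
    1 + ∫ x, f x ∂μ - ∫ x, Real.exp (f x) ∂ν ≤ (klDiv μ ν).toReal := by
  obtain ⟨hac, hint⟩ := klDiv_ne_top_iff.1 hfin
  rw [toReal_klDiv_eq_integral_klFun hac]
  have h1 : ∫ x, f x ∂μ = ∫ x, (μ.rnDeriv ν x).toReal * f x ∂ν :=
    (integral_rnDeriv_smul hac).symm
  have hi1 := integrable_rnDeriv_toReal_mul (μ := μ) (ν := ν) hf hM
  have hi2 := integrable_exp_of_abs_le (μ := ν) hf hM
  calc 1 + ∫ x, f x ∂μ - ∫ x, Real.exp (f x) ∂ν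
      = ∫ x, ((μ.rnDeriv ν x).toReal * f x - Real.exp (f x) + 1) ∂ν := by
        rw [integral_sub_add_one hi1 hi2, h1]
    _ ≤ _ := integral_mono ((hi1.sub hi2).add (integrable_const _))
        ((integrable_klFun_rnDeriv_iff hac).2 hint)
        fun x => mul_sub_exp_le_klFun ENNReal.toReal_nonneg _

/-- With c the clamped value, the expression is (g - c) log c + klFun c. Clamping to an interval
around 1 gives g - c the sign of log c. This positivity is what permits Fatou below. -/
theorem mul_log_clamp_nonneg {g N : ℝ} (hN : 1 ≤ N) :
    0 ≤ g * Real.log (max (min g N) N⁻¹) - max (min g N) N⁻¹ + 1 := by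
  set c := max (min g N) N⁻¹ with hc
  have hN' : N⁻¹ ≤ 1 := inv_le_one_of_one_le₀ hN
  have hN0 : 0 < N⁻¹ := by positivity
  have hc0 : 0 < c := lt_of_lt_of_le hN0 (le_max_right _ _)
  have h1 : 0 ≤ (g - c) * Real.log c := by
    rcases le_total g N⁻¹ with h | h
    · have : c = N⁻¹ := max_eq_right ((min_le_left _ _).trans h)
      rw [this]
      exact mul_nonneg_of_nonpos_of_nonpos (by linarith) (Real.log_nonpos hN0.le hN')
    · rcases le_total g N with h' | h'
      · have : c = g := by rw [hc, min_eq_left h', max_eq_left h]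
        simp [this]
      · have : c = N := by rw [hc, min_eq_right h', max_eq_left (hN'.trans hN)]
        rw [this]
        exact mul_nonneg (by linarith) (Real.log_nonneg hN)
  have h2 := klFun_nonneg hc0.le
  rw [klFun_apply] at h2
  linarith

theorem tendsto_mul_log_clamp {g : ℝ} (hg : 0 ≤ g) :
    Tendsto (fun n : ℕ => g * Real.log (max (min g (n + 1 : ℝ)) (n + 1 : ℝ)⁻¹)
      - max (min g (n + 1 : ℝ)) (n + 1 : ℝ)⁻¹ + 1) atTop (𝓝 (klFun g)) := by
  have h0 : Tendsto (fun n : ℕ => ((n : ℝ) + 1)⁻¹) atTop (𝓝 0) := by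
    simpa using tendsto_one_div_add_atTop_nhds_zero_nat (𝕜 := ℝ)
  have h1 : Tendsto (fun n : ℕ => (n : ℝ) + 1) atTop atTop :=
    tendsto_atTop_add_const_right _ _ tendsto_natCast_atTop_atTop
  rcases hg.eq_or_lt with rfl | hg
  · have h2 : ∀ n : ℕ, max (min 0 ((n : ℝ) + 1)) ((n : ℝ) + 1)⁻¹ = ((n : ℝ) + 1)⁻¹ := fun n => by
      rw [min_eq_left (by positivity), max_eq_right (by positivity)]
    simp only [h2, zero_mul, klFun_zero]
    simpa using (h0.const_sub 0).add_const 1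
  · refine tendsto_const_nhds.congr' ?_
    filter_upwards [h0.eventually_lt_const hg, h1.eventually_ge_atTop g] with n hn1 hn2
    rw [min_eq_left hn2, max_eq_left hn1.le, klFun_apply]
    ring

/-- The hard half of the Donsker–Varadhan formula. -/
theorem klDiv_le_of_forall_abs_le {μ ν : Measure A} [IsProbabilityMeasure μ]
    [IsProbabilityMeasure ν] {c : ℝ}
    (hc : ∀ f : A → ℝ, Measurable f → ∀ M : ℝ, (∀ x, |f x| ≤ M) →
      1 + ∫ x, f x ∂μ - ∫ x, Real.exp (f x) ∂ν ≤ c) :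
    klDiv μ ν ≤ ENNReal.ofReal c := by
  -- Test with t times the indicator of a ν-null set: the exponential integral stays 1 while the
  -- linear term grows like t μ(s), contradicting the bound `c`.
  have hac : μ ≪ ν := by
    refine Measure.AbsolutelyContinuous.mk fun s hs h0 => ?_
    by_contra hne
    have hpos : 0 < μ.real s := ENNReal.toReal_pos hne (measure_ne_top _ _)
    have h1 : ∀ t : ℝ, 0 ≤ t → t * μ.real s ≤ c := fun t ht => by
      have h2 := hc (s.indicator fun _ => t) (measurable_const.indicator hs) t fun x => by
        by_cases hx : x ∈ s <;> simp [hx, abs_of_nonneg ht, ht]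
      have h3 : ∫ x, Real.exp (s.indicator (fun _ => t) x) ∂ν = 1 := by
        have : (fun x => Real.exp (s.indicator (fun _ => t) x)) =ᵐ[ν] fun _ => 1 := by
          have hs0 : ∀ᵐ x ∂ν, x ∉ s := measure_eq_zero_iff_ae_notMem.1 h0
          filter_upwards [hs0] with x hx
          simp [hx]
        rw [integral_congr_ae this]
        simp
      rw [h3, integral_indicator_const _ hs, smul_eq_mul] at h2
      linarith
    have h4 := h1 ((|c| + 1) / μ.real s) (by positivity)
    rw [div_mul_cancel₀ _ hpos.ne'] at h4
    linarith [le_abs_self c]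
  rw [klDiv_eq_lintegral_klFun_of_ac hac]
  set g : A → ℝ := fun x => (μ.rnDeriv ν x).toReal with hg
  have hgm : Measurable g := (Measure.measurable_rnDeriv _ _).ennreal_toReal
  -- The optimal test function is log g, which is unbounded; the clamped versions are admissible and
  -- Fatou recovers the limit.
  set cl : ℕ → A → ℝ := fun n x => max (min (g x) (n + 1 : ℝ)) (n + 1 : ℝ)⁻¹ with hcl
  have hclm : ∀ n, Measurable (cl n) := fun n => by fun_prop
  set F : ℕ → A → ℝ := fun n x => g x * Real.log (cl n x) - cl n x + 1 with hF
  have hFm : ∀ n, Measurable (F n) := fun n => by fun_prop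
  have hN : ∀ n : ℕ, (1 : ℝ) ≤ n + 1 := fun n => by simp
  have hF0 : ∀ n x, 0 ≤ F n x := fun n x => mul_log_clamp_nonneg (hN n)
  have hcl0 : ∀ (n : ℕ) x, ((n : ℝ) + 1)⁻¹ ≤ cl n x := fun n x => le_max_right _ _
  have hcl1 : ∀ (n : ℕ) x, cl n x ≤ n + 1 := fun n x =>
    max_le (min_le_right _ _) ((inv_le_one_of_one_le₀ (hN n)).trans (hN n))
  have hclpos : ∀ (n : ℕ) x, 0 < cl n x := fun n x =>
    lt_of_lt_of_le (by positivity) (hcl0 n x)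
  have hlog : ∀ (n : ℕ) x, |Real.log (cl n x)| ≤ Real.log (n + 1) := fun n x => by
    rw [abs_le, ← Real.log_inv]
    exact ⟨Real.log_le_log (by positivity) (hcl0 n x), Real.log_le_log (hclpos n x) (hcl1 n x)⟩
  have hFint : ∀ n, ∫⁻ x, ENNReal.ofReal (F n x) ∂ν ≤ ENNReal.ofReal c := fun n => by
    have h1 := hc (fun x => Real.log (cl n x)) (hclm n).log _ (hlog n)
    simp only [Real.exp_log (hclpos n _)] at h1
    have hi1 : Integrable (fun x => g x * Real.log (cl n x)) ν :=
      integrable_rnDeriv_toReal_mul (hclm n).log (hlog n)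
    have hi2 : Integrable (cl n) ν := integrable_of_abs_le (hclm n) (M := n + 1) fun x => by
      rw [abs_of_pos (hclpos n x)]; exact hcl1 n x
    have hi : Integrable (F n) ν := (hi1.sub hi2).add (integrable_const _)
    rw [← ofReal_integral_eq_lintegral_ofReal hi
      (Eventually.of_forall (hF0 n))]
    refine ENNReal.ofReal_le_ofReal (le_trans (le_of_eq ?_) h1)
    have h2 : ∫ x, Real.log (cl n x) ∂μ = ∫ x, g x * Real.log (cl n x) ∂ν :=
      (integral_rnDeriv_smul hac).symm
    rw [integral_sub_add_one hi1 hi2, h2]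
  calc ∫⁻ x, ENNReal.ofReal (klFun (g x)) ∂ν
      = ∫⁻ x, liminf (fun n => ENNReal.ofReal (F n x)) atTop ∂ν := by
        refine lintegral_congr fun x => ?_
        exact ((ENNReal.continuous_ofReal.tendsto _).comp
          (tendsto_mul_log_clamp ENNReal.toReal_nonneg)).liminf_eq.symm
    _ ≤ liminf (fun n => ∫⁻ x, ENNReal.ofReal (F n x) ∂ν) atTop :=
        lintegral_liminf_le fun n => (hFm n).ennreal_ofReal
    _ ≤ ENNReal.ofReal c := by
        refine (liminf_le_liminf (Eventually.of_forall hFint)).trans ?_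
        simp

theorem exp_sub_exp_le {u v M : ℝ} (hu : u ≤ M) :
    Real.exp u - Real.exp v ≤ Real.exp M * |u - v| := by
  have h1 := Real.add_one_le_exp (v - u)
  rw [Real.exp_sub, le_div_iff₀ (Real.exp_pos u)] at h1
  calc Real.exp u - Real.exp v ≤ Real.exp u * (u - v) := by nlinarith
    _ ≤ Real.exp u * |u - v| := by gcongr; exact le_abs_self _
    _ ≤ _ := by gcongr

end DonskerVaradhan

/-! ### Densities of corrupted laws. -/

section Feller

variable {X : Type*} [TopologicalSpace X] [CompactSpace X] [MeasurableSpace X]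
  {Y : Type*} [MeasurableSpace Y] {ν : Measure Y} (r : CorruptionDensity X Y ν)

theorem corruptDensity_ne_top (hr : ∀ y, Continuous fun x => r.density x y)
    (p : ProbabilityMeasure X) (y : Y) : corruptDensity r p y ≠ ∞ := by
  obtain ⟨M, hM⟩ := (isCompact_range (hr y)).bddAbove
  refine ne_top_of_le_ne_top (b := (M : ℝ≥0∞)) ENNReal.coe_ne_top ?_
  calc corruptDensity r p y ≤ ∫⁻ _, (M : ℝ≥0∞) ∂(p : Measure X) :=
        lintegral_mono fun x => ENNReal.coe_le_coe.2 (hM ⟨x, rfl⟩)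
    _ = M := by simp

theorem continuous_corruptDensity [OpensMeasurableSpace X]
    (hr : ∀ y, Continuous fun x => r.density x y) (y : Y) :
    Continuous fun p => corruptDensity r p y := by
  rw [continuous_iff_continuousAt]
  intro p
  exact (ProbabilityMeasure.tendsto_iff_forall_lintegral_tendsto.1 tendsto_id)
    (BoundedContinuousFunction.mkOfCompact ⟨fun x => r.density x y, hr y⟩)

theorem withDensity_corruptDensity_eq (hr : ∀ y, Continuous fun x => r.density x y)
    (p p' : ProbabilityMeasure X) :
    ν.withDensity (corruptDensity r p) = (ν.withDensity (corruptDensity r p')).withDensity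
      (fun y => corruptDensity r p y / corruptDensity r p' y) := by
  have hm' := measurable_corruptDensity r p'
  have hd : Measurable fun y => corruptDensity r p y / corruptDensity r p' y :=
    (measurable_corruptDensity r p).div hm'
  rw [← withDensity_mul _ hm' hd]
  congr 1
  funext y
  exact (ENNReal.mul_div_cancel (corruptDensity_ne_zero r p' y)
    (corruptDensity_ne_top r hr p' y)).symm

/-- Integrating against `ν`, which does not depend on `p'`, prepares Fatou's lemma for varying `p'`.
-/
theorem KL_corrupt_eq_lintegral [SigmaFinite ν] (hr : ∀ y, Continuous fun x => r.density x y)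
    (p p' : ProbabilityMeasure X) :
    KL (corrupt r p) (corrupt r p') = ∫⁻ y, corruptDensity r p' y *
      ENNReal.ofReal (klFun (corruptDensity r p y / corruptDensity r p' y).toReal) ∂ν := by
  have hm' := measurable_corruptDensity r p'
  have hd : Measurable fun y => corruptDensity r p y / corruptDensity r p' y :=
    (measurable_corruptDensity r p).div hm'
  have h1 := withDensity_corruptDensity_eq r hr p p'
  have : IsProbabilityMeasure (ν.withDensity (corruptDensity r p')) := (corrupt r p').2
  have h2 : ∫⁻ y, corruptDensity r p y / corruptDensity r p' y
      ∂(ν.withDensity (corruptDensity r p')) ≠ ∞ := by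
    rw [← setLIntegral_univ, ← withDensity_apply _ MeasurableSet.univ, ← h1,
      withDensity_apply _ MeasurableSet.univ, setLIntegral_univ, lintegral_corruptDensity]
    exact ENNReal.one_ne_top
  change klDiv (ν.withDensity (corruptDensity r p)) (ν.withDensity (corruptDensity r p')) = _
  rw [h1, klDiv_withDensity_left _ hd h2,
    lintegral_withDensity_eq_lintegral_mul _ hm' (by fun_prop)]
  rfl

end Feller

/-! ### Lower semicontinuity of the objective. -/

section Topology

variable {X : Type*} [TopologicalSpace X] [CompactSpace X] [TopologicalSpace.MetrizableSpace X]
  [MeasurableSpace X] [BorelSpace X]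

/-- Continuous test functions suffice in the Donsker–Varadhan formula. -/
theorem dv_le_of_forall_continuous (μ ν : Measure X) [IsProbabilityMeasure μ]
    [IsProbabilityMeasure ν] {c : ℝ}
    (hc : ∀ f : C(X, ℝ), 1 + ∫ x, f x ∂μ - ∫ x, Real.exp (f x) ∂ν ≤ c)
    {f : X → ℝ} (hf : Measurable f) {M : ℝ} (hM : ∀ x, |f x| ≤ M) :
    1 + ∫ x, f x ∂μ - ∫ x, Real.exp (f x) ∂ν ≤ c := by
  refine le_of_forall_pos_le_add fun ε hε => ?_
  -- Replacing f by an approximation costs its L¹(μ) distance in the linear term and at most exp M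
  -- times its L¹(ν) distance in the exponential one, so accuracy ε / D in L¹(μ + ν) suffices.
  set D := 1 + Real.exp M with hD
  have hD0 : 0 < D := by positivity
  obtain ⟨g, hg, hgi⟩ := (integrable_of_abs_le (μ := μ + ν) hf hM).exists_boundedContinuous_integral_sub_le
    (div_pos hε hD0)
  -- Clamping to the range of f controls the exponential and cannot increase the distance to f.
  let g' : C(X, ℝ) := ⟨fun x => max (-M) (min (g x) M), by fun_prop⟩
  have hM0 : ∀ x, 0 ≤ M := fun x => (abs_nonneg _).trans (hM x)
  have hg'M : ∀ x, |g' x| ≤ M := fun x => abs_le.2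
    ⟨le_max_left _ _, max_le (by linarith [hM0 x]) (min_le_right _ _)⟩
  have hcl : ∀ x, |f x - g' x| ≤ ‖f x - g x‖ := fun x => by
    have h1 : f x = max (-M) (min (f x) M) := by
      rw [min_eq_left (abs_le.1 (hM x)).2, max_eq_right (abs_le.1 (hM x)).1]
    calc |f x - g' x| = |max (-M) (min (f x) M) - max (-M) (min (g x) M)| := by rw [← h1]; rfl
      _ ≤ |min (f x) M - min (g x) M| := abs_max_sub_max_le_abs _ _ _ |>.trans' (by
          rw [max_comm (-M), max_comm (-M)])
      _ ≤ |f x - g x| := abs_min_sub_min_le_max _ _ _ _ |>.trans (by simp)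
  have hg'm : Measurable g' := g'.continuous.measurable
  have hdm : Measurable fun x => |f x - g' x| := (hf.sub hg'm).abs
  have hdb : ∀ x, |(|f x - g' x|)| ≤ 2 * M := fun x => by
    rw [abs_abs]
    calc |f x - g' x| ≤ |f x| + |g' x| := abs_sub _ _
      _ ≤ _ := by linarith [hM x, hg'M x]
  have hdμ : Integrable (fun x => |f x - g' x|) μ := integrable_of_abs_le hdm hdb
  have hdν : Integrable (fun x => |f x - g' x|) ν := integrable_of_abs_le hdm hdb
  have hsum : ∫ x, |f x - g' x| ∂μ + ∫ x, |f x - g' x| ∂ν ≤ ε / D := by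
    rw [← integral_add_measure hdμ hdν]
    refine le_trans (integral_mono (integrable_of_abs_le hdm hdb) ?_ hcl) hg
    exact ((integrable_of_abs_le (μ := μ + ν) hf hM).sub hgi).norm
  have hp1 : 0 ≤ ∫ x, |f x - g' x| ∂μ := integral_nonneg fun x => abs_nonneg _
  have hp2 : 0 ≤ ∫ x, |f x - g' x| ∂ν := integral_nonneg fun x => abs_nonneg _
  have hA : ∫ x, f x ∂μ - ∫ x, g' x ∂μ ≤ ∫ x, |f x - g' x| ∂μ := by
    rw [← integral_sub (integrable_of_abs_le hf hM) (integrable_of_abs_le hg'm hg'M)]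
    exact integral_mono ((integrable_of_abs_le hf hM).sub (integrable_of_abs_le hg'm hg'M)) hdμ
      fun x => le_abs_self _
  have hB : ∫ x, Real.exp (g' x) ∂ν - ∫ x, Real.exp (f x) ∂ν
      ≤ Real.exp M * ∫ x, |f x - g' x| ∂ν := by
    rw [← integral_sub (integrable_exp_of_abs_le hg'm hg'M) (integrable_exp_of_abs_le hf hM),
      ← integral_const_mul]
    refine integral_mono ((integrable_exp_of_abs_le hg'm hg'M).sub
      (integrable_exp_of_abs_le hf hM)) (hdν.const_mul _) fun x => ?_
    change Real.exp (g' x) - Real.exp (f x) ≤ Real.exp M * |f x - g' x|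
    rw [abs_sub_comm]
    exact exp_sub_exp_le ((le_abs_self _).trans (hg'M x))
  have hC := hc g'
  have hE : D * (ε / D) = ε := mul_div_cancel₀ _ hD0.ne'
  have hM1 := Real.exp_pos M
  nlinarith

/-- By Donsker–Varadhan a finite sublevel set is an intersection, over continuous test functions, of
weakly closed conditions. -/
theorem lowerSemicontinuous_KL_right (μ : ProbabilityMeasure X) :
    LowerSemicontinuous (KL μ) := by
  rw [lowerSemicontinuous_iff_isClosed_preimage]
  intro c
  by_cases hc : c = ∞
  · simp [hc]
  have : KL μ ⁻¹' Set.Iic c = ⋂ f : C(X, ℝ), {p : ProbabilityMeasure X |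
      1 + ∫ x, f x ∂(μ : Measure X) - ∫ x, Real.exp (f x) ∂(p : Measure X) ≤ c.toReal} := by
    ext p
    simp only [Set.mem_preimage, Set.mem_Iic, Set.mem_iInter, Set.mem_ofPred_eq]
    refine ⟨fun hp f => ?_, fun hp => ?_⟩
    · have hfin : KL μ p ≠ ∞ := ne_top_of_le_ne_top hc hp
      exact (le_klDiv_of_abs_le f.continuous.measurable (f.norm_coe_le_norm) hfin).trans
        (ENNReal.toReal_mono hc hp)
    · rw [← ENNReal.ofReal_toReal hc]
      exact klDiv_le_of_forall_abs_le fun f hf M hM =>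
        dv_le_of_forall_continuous _ _ hp hf hM
  rw [this]
  refine isClosed_iInter fun f => isClosed_le (continuous_const.sub ?_) continuous_const
  exact ProbabilityMeasure.continuous_integral_boundedContinuousFunction
    (BoundedContinuousFunction.mkOfCompact ⟨fun x => Real.exp (f x), by fun_prop⟩)

variable {Y : Type*} [MeasurableSpace Y] {ν : Measure Y} (r : CorruptionDensity X Y ν)

/-- Continuity of r(y | ·) makes the corrupted densities converge at every y under weak convergence,
and Fatou does the rest. -/
theorem lowerSemicontinuous_KL_corrupt [SigmaFinite ν]
    (hr : ∀ y, Continuous fun x => r.density x y) (pdata : ProbabilityMeasure X) :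
    LowerSemicontinuous fun p => KL (corrupt r pdata) (corrupt r p) := by
  rw [lowerSemicontinuous_iff_isClosed_preimage]
  intro c
  refine IsSeqClosed.isClosed fun p p' hp hlim => ?_
  simp only [Set.mem_preimage, Set.mem_Iic, KL_corrupt_eq_lintegral r hr] at hp ⊢
  have hm := measurable_corruptDensity r pdata
  calc _ = ∫⁻ y, liminf (fun n => corruptDensity r (p n) y * ENNReal.ofReal (klFun
          (corruptDensity r pdata y / corruptDensity r (p n) y).toReal)) atTop ∂ν := by
        refine lintegral_congr fun y => (Tendsto.liminf_eq ?_).symm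
        have h0 := corruptDensity_ne_zero r p' y
        have ht := corruptDensity_ne_top r hr p' y
        have h1 : Tendsto (fun n => corruptDensity r (p n) y) atTop (𝓝 (corruptDensity r p' y)) :=
          ((continuous_corruptDensity r hr y).tendsto p').comp hlim
        have h2 := ENNReal.Tendsto.const_div h1 (a := corruptDensity r pdata y)
          (Or.inr (corruptDensity_ne_top r hr pdata y))
        have h3 := (ENNReal.tendsto_toReal (ENNReal.div_ne_top
          (corruptDensity_ne_top r hr pdata y) h0)).comp h2
        exact ENNReal.Tendsto.mul h1 (Or.inl h0) (((ENNReal.continuous_ofReal.comp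
          continuous_klFun).tendsto _).comp h3) (Or.inr ht)
    _ ≤ liminf (fun n => ∫⁻ y, corruptDensity r (p n) y * ENNReal.ofReal (klFun
          (corruptDensity r pdata y / corruptDensity r (p n) y).toReal) ∂ν) atTop :=
        lintegral_liminf_le fun n => by
          have := measurable_corruptDensity r (p n)
          fun_prop
    _ ≤ c := (liminf_le_liminf (Eventually.of_forall hp)).trans (by simp)

theorem lowerSemicontinuous_objective [SigmaFinite ν]
    (hr : ∀ y, Continuous fun x => r.density x y) (pdata h : ProbabilityMeasure X) (lam : ℝ≥0) :
    LowerSemicontinuous (objective r pdata h lam) := by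
  refine (lowerSemicontinuous_KL_corrupt r hr pdata).add ?_
  exact (ENNReal.continuous_const_mul ENNReal.coe_ne_top).comp_lowerSemicontinuous
    (lowerSemicontinuous_KL_right h) fun a b hab => mul_le_mul_right hab _

end Topology

/-! ### Divergences from measures dominating a common measure. -/

section Comparison

variable {A : Type*} [MeasurableSpace A] {μ ν ν' : Measure A} [IsProbabilityMeasure μ]
  [IsProbabilityMeasure ν] [IsProbabilityMeasure ν']

theorem le_rnDeriv_of_withDensity_le {A : Type*} [MeasurableSpace A] {ν ν' : Measure A}
    [IsFiniteMeasure ν] [IsFiniteMeasure ν'] {f : A → ℝ≥0∞} (hf : Measurable f)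
    (hle : ν.withDensity f ≤ ν') : f ≤ᵐ[ν] ν'.rnDeriv ν := by
  have : IsFiniteMeasure (ν.withDensity f) := isFiniteMeasure_of_le ν' hle
  have h1 : ν' - ν.withDensity f + ν.withDensity f = ν' := Measure.sub_add_cancel_of_le hle
  have h2 := Measure.rnDeriv_add' (ν' - ν.withDensity f) (ν.withDensity f) ν
  rw [h1] at h2
  filter_upwards [h2, Measure.rnDeriv_withDensity ν hf] with x hx1 hx2
  rw [hx1, Pi.add_apply, hx2]
  exact le_add_self

theorem absolutelyContinuous_of_le_nnreal_smul {A : Type*} [MeasurableSpace A] {ν ν' : Measure A}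
    {C : ℝ≥0} (hC : ν ≤ C • ν') : ν ≪ ν' :=
  (Measure.absolutelyContinuous_of_le hC).trans (Measure.smul_absolutelyContinuous)

theorem neg_log_le_llr {C : ℝ≥0} (hC : ν ≤ C • ν') :
    ∀ᵐ x ∂ν, 0 ≤ llr ν' ν x + Real.log C := by
  have hC0 : C ≠ 0 := by
    rintro rfl
    have h1 := hC Set.univ
    simp at h1
  have h1 : ν.withDensity (fun _ => ((C⁻¹ : ℝ≥0) : ℝ≥0∞)) ≤ ν' := by
    rw [withDensity_const]
    intro s
    have h2 := hC s
    simp only [Measure.smul_apply, ENNReal.smul_def, smul_eq_mul] at h2 ⊢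
    calc ((C⁻¹ : ℝ≥0) : ℝ≥0∞) * ν s ≤ ((C⁻¹ : ℝ≥0) : ℝ≥0∞) * (C * ν' s) := by gcongr
      _ = ν' s := by
        rw [← mul_assoc, ← ENNReal.coe_mul, inv_mul_cancel₀ hC0, ENNReal.coe_one, one_mul]
  filter_upwards [le_rnDeriv_of_withDensity_le measurable_const h1,
    Measure.rnDeriv_lt_top ν' ν] with x hx1 hx2
  have h3 : ((C⁻¹ : ℝ≥0) : ℝ) ≤ (ν'.rnDeriv ν x).toReal := by
    have := ENNReal.toReal_mono hx2.ne hx1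
    simpa using this
  have hCpos : (0 : ℝ) < C := by exact_mod_cast pos_iff_ne_zero.2 hC0
  have h4 := Real.log_le_log (by simpa using hCpos) h3
  rw [NNReal.coe_inv, Real.log_inv] at h4
  rw [llr]
  linarith

theorem llr_eq_llr_sub_llr (h1 : μ ≪ ν) (h2 : ν ≪ ν') :
    llr μ ν' =ᵐ[μ] fun x => llr μ ν x - llr ν' ν x := by
  have hmul := (h1.trans h2).ae_le (Measure.rnDeriv_mul_rnDeriv (κ := ν') h1)
  filter_upwards [hmul, Measure.rnDeriv_pos h1, h1.ae_le (Measure.rnDeriv_pos h2),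
    h1.ae_le (neg_llr h2), h1.ae_le (Measure.rnDeriv_lt_top μ ν),
    (h1.trans h2).ae_le (Measure.rnDeriv_lt_top ν ν')] with x hx p1 p2 hn t1 t2
  rw [← hn, Pi.neg_apply, sub_neg_eq_add, llr, llr, llr, ← hx, Pi.mul_apply, ENNReal.toReal_mul,
    Real.log_mul (ENNReal.toReal_pos p1.ne' t1.ne).ne' (ENNReal.toReal_pos p2.ne' t2.ne).ne']

/-- Domination bounds llr μ ν' above by U = llr μ ν + log C. Below, d log d ≥ d - 1 for the density
d. Hence d |log d| ≤ 1 + d |U|. -/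
theorem integrable_llr_of_le_smul (hac : μ ≪ ν) (hint : Integrable (llr μ ν) μ) {C : ℝ≥0}
    (hC : ν ≤ C • ν') : Integrable (llr μ ν') μ := by
  have h2 : ν ≪ ν' := absolutelyContinuous_of_le_nnreal_smul hC
  have hac' : μ ≪ ν' := hac.trans h2
  rw [← integrable_rnDeriv_mul_log_iff hac']
  set U : A → ℝ := fun x => llr μ ν x + Real.log C with hU
  have hUi : Integrable U μ := hint.add (integrable_const _)
  have hb : Integrable (fun x => 1 + (μ.rnDeriv ν' x).toReal * |U x|) ν' :=
    (integrable_const _).add ((integrable_toReal_rnDeriv_mul_iff hac').2 hUi.abs)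
  have hle : ∀ᵐ x ∂μ, llr μ ν' x ≤ U x := by
    filter_upwards [llr_eq_llr_sub_llr hac h2, hac.ae_le (neg_log_le_llr hC)] with x hx1 hx2
    rw [hx1]
    simp only [hU]
    linarith
  refine hb.mono' (by fun_prop) ?_
  filter_upwards [Measure.ae_rnDeriv_ne_zero_imp_of_ae (ν := ν') hle] with x hx
  set d := μ.rnDeriv ν' x with hd
  by_cases hd0 : d = 0
  · simp [hd0]
  have h3 := hx hd0
  have hdn : 0 ≤ d.toReal := ENNReal.toReal_nonneg
  have h4 := klFun_nonneg hdn
  rw [klFun_apply] at h4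
  rw [Real.norm_eq_abs, abs_le]
  have h5 : d.toReal * Real.log d.toReal ≤ d.toReal * |U x| := by
    gcongr
    exact h3.trans (le_abs_self _)
  have h6 : 0 ≤ d.toReal * |U x| := by positivity
  constructor <;> linarith

theorem klDiv_ne_top_of_le_smul (hfin : klDiv μ ν ≠ ∞) {C : ℝ≥0} (hC : ν ≤ C • ν') :
    klDiv μ ν' ≠ ∞ := by
  obtain ⟨hac, hint⟩ := klDiv_ne_top_iff.1 hfin
  exact klDiv_ne_top (hac.trans (absolutelyContinuous_of_le_nnreal_smul hC))
    (integrable_llr_of_le_smul hac hint hC)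

/-- The chain rule for log-likelihood ratios, with log C added so that the integrand is nonnegative.
It converts upper bounds on the divergence into lower bounds on an integral. -/
theorem klDiv_add_lintegral_llr (hfin : klDiv μ ν ≠ ∞) {C : ℝ≥0} (hC : ν ≤ C • ν') :
    klDiv μ ν' + ∫⁻ x, ENNReal.ofReal (llr ν' ν x + Real.log C) ∂μ
      = klDiv μ ν + ENNReal.ofReal (Real.log C) := by
  obtain ⟨hac, hint⟩ := klDiv_ne_top_iff.1 hfin
  have h2 : ν ≪ ν' := absolutelyContinuous_of_le_nnreal_smul hC
  have hint' := integrable_llr_of_le_smul hac hint hC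
  have hfin' := klDiv_ne_top_of_le_smul hfin hC
  have hlog : 0 ≤ Real.log C := by
    refine Real.log_nonneg ?_
    have h1 := hC Set.univ
    simp only [Measure.smul_apply, measure_univ, ENNReal.smul_def, smul_eq_mul, mul_one] at h1
    exact_mod_cast h1
  have heq := llr_eq_llr_sub_llr hac h2
  have hi : Integrable (llr ν' ν) μ := by
    refine (hint.sub hint').congr ?_
    filter_upwards [heq] with x hx
    rw [Pi.sub_apply, hx]
    ring
  have h3 : ∫ x, llr μ ν' x ∂μ = ∫ x, llr μ ν x ∂μ - ∫ x, llr ν' ν x ∂μ := by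
    rw [integral_congr_ae heq, integral_sub hint hi]
  have hi' : Integrable (fun x => llr ν' ν x + Real.log C) μ := hi.add (integrable_const _)
  have hnn := hac.ae_le (neg_log_le_llr hC)
  have h4 : ∫ x, (llr ν' ν x + Real.log C) ∂μ = ∫ x, llr ν' ν x ∂μ + Real.log C := by
    rw [integral_add hi (integrable_const _)]
    simp
  rw [← ofReal_integral_eq_lintegral_ofReal hi' hnn, ← ENNReal.ofReal_toReal hfin',
    ← ENNReal.ofReal_toReal hfin,
    toReal_klDiv_of_measure_eq hac (by simp), toReal_klDiv_of_measure_eq (hac.trans h2) (by simp),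
    ← ENNReal.ofReal_add _ (integral_nonneg_of_ae hnn), ← ENNReal.ofReal_add _ hlog, h4, h3]
  · congr 1; ring
  · rw [← toReal_klDiv_of_measure_eq hac (by simp)]; exact ENNReal.toReal_nonneg
  · rw [← toReal_klDiv_of_measure_eq (hac.trans h2) (by simp)]; exact ENNReal.toReal_nonneg

/-- Upper semicontinuity of the Kullback–Leibler divergence under a common lower bound. -/
theorem eventually_klDiv_lt (hfin : klDiv μ ν ≠ ∞) {C : ℝ≥0} (hC : ν ≤ C • ν')
    {νs : ℕ → Measure A} (hp : ∀ n, IsProbabilityMeasure (νs n)) (hCs : ∀ n, ν ≤ C • νs n)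
    (hlim : ∀ᵐ x ∂μ, ∀ b < llr ν' ν x, ∀ᶠ n in atTop, b ≤ llr (νs n) ν x)
    {c : ℝ≥0∞} (hc : klDiv μ ν' < c) : ∀ᶠ n in atTop, klDiv μ (νs n) < c := by
  -- The divergence and the shifted integral `a n` always add up to this finite constant, so Fatou
  -- for `a` bounds the limsup of the divergences.
  set B := klDiv μ ν + ENNReal.ofReal (Real.log C) with hB
  have hBt : B ≠ ∞ := ENNReal.add_ne_top.2 ⟨hfin, ENNReal.ofReal_ne_top⟩
  set a : ℕ → ℝ≥0∞ := fun n => ∫⁻ x, ENNReal.ofReal (llr (νs n) ν x + Real.log C) ∂μ with ha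
  have h1 : ∀ n, klDiv μ (νs n) + a n = B := fun n => klDiv_add_lintegral_llr hfin (hCs n)
  have h2 : klDiv μ ν' + ∫⁻ x, ENNReal.ofReal (llr ν' ν x + Real.log C) ∂μ = B :=
    klDiv_add_lintegral_llr hfin hC
  have hat : ∀ n, a n ≠ ∞ := fun n => ne_top_of_le_ne_top hBt ((h1 n).symm ▸ le_add_self)
  have hfatou : ∫⁻ x, ENNReal.ofReal (llr ν' ν x + Real.log C) ∂μ ≤ liminf a atTop := by
    refine le_trans (lintegral_mono_ae ?_) (lintegral_liminf_le fun n => by fun_prop)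
    filter_upwards [hlim] with x hx
    refine le_of_forall_lt fun b hb => ?_
    have hbt : b ≠ ∞ := hb.ne_top
    obtain ⟨b', hb1, hb2⟩ := exists_between hb
    have hbt' : b' ≠ ∞ := hb2.ne_top
    rw [← ENNReal.ofReal_toReal hbt', ENNReal.ofReal_lt_ofReal_iff_of_nonneg
      ENNReal.toReal_nonneg] at hb2
    refine lt_of_lt_of_le hb1 (le_liminf_of_le (by isBoundedDefault) ?_)
    filter_upwards [hx (b'.toReal - Real.log C) (by linarith)] with n hn
    rw [← ENNReal.ofReal_toReal hbt']
    exact ENNReal.ofReal_le_ofReal (by linarith)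
  have hlimsup : limsup (fun n => klDiv μ (νs n)) atTop < c := by
    have h3 : (fun n => klDiv μ (νs n)) = fun n => B - a n := by
      funext n
      exact ENNReal.eq_sub_of_add_eq (hat n) (h1 n)
    rw [h3, ENNReal.limsup_const_sub _ _ hBt]
    refine lt_of_le_of_lt (tsub_le_tsub_left hfatou B) ?_
    refine lt_of_le_of_lt ?_ hc
    rw [tsub_le_iff_right, h2]
  exact eventually_lt_of_limsup_lt hlimsup

theorem log_le_llr_of_withDensity_le {g : A → ℝ≥0∞} (hg : Measurable g)
    (hgt : ∀ᵐ x ∂ν, g x ≠ ∞) (hle : ν.withDensity g ≤ ν') :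
    ∀ᵐ x ∂ν, g x ≠ 0 → Real.log (g x).toReal ≤ llr ν' ν x := by
  filter_upwards [le_rnDeriv_of_withDensity_le hg hle, hgt, Measure.rnDeriv_lt_top ν' ν]
    with x h1 h2 h3 h0
  exact Real.log_le_log (ENNReal.toReal_pos h0 h2) (ENNReal.toReal_mono h3.ne h1)

end Comparison

/-! ### Weak approximation by measures of bounded density. -/

section Smoothing

variable {X : Type*} [MetricSpace X] [CompactSpace X] [MeasurableSpace X] [BorelSpace X]

/-- On a compact metric space, every measure of full support admits Markov kernels with bounded
densities which move points by less than any prescribed distance. -/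
theorem exists_smoothing_kernel (h : Measure X) [IsProbabilityMeasure h] (hsupp : h.IsOpenPosMeasure)
    {δ : ℝ} (hδ : 0 < δ) :
    ∃ S : Kernel X X, ∃ C : ℝ≥0, IsMarkovKernel S ∧ (∀ x, S x ≤ C • h) ∧
      ∀ x, ∀ᵐ z ∂(S x), dist z x < δ := by
  have : SecondCountableTopology X := inferInstance
  have hmeas : ∀ s : Set X, MeasurableSet s → Measurable fun x => h (s ∩ Metric.ball x δ) := by
    intro s hs
    have hm : MeasurableSet {z : X × X | z.2 ∈ s ∧ dist z.2 z.1 < δ} :=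
      (measurable_snd hs).inter
        (measurableSet_lt (measurable_snd.dist measurable_fst) measurable_const)
    exact measurable_measure_prodMk_left hm
  have hpos : ∀ x, h (Metric.ball x δ) ≠ 0 := fun x =>
    (Metric.isOpen_ball.measure_pos h ⟨x, Metric.mem_ball_self hδ⟩).ne'
  have happ : ∀ x s, MeasurableSet s → ((h (Metric.ball x δ))⁻¹ • h.restrict (Metric.ball x δ)) s
      = (h (Metric.ball x δ))⁻¹ * h (s ∩ Metric.ball x δ) := fun x s hs => by
    rw [Measure.smul_apply, Measure.restrict_apply hs, smul_eq_mul]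
  -- The law `h` conditioned on the δ-ball around the point; full support makes the normalization
  -- possible.
  let S : Kernel X X :=
    { toFun := fun x => (h (Metric.ball x δ))⁻¹ • h.restrict (Metric.ball x δ)
      measurable' := by
        refine Measure.measurable_of_measurable_coe _ fun s hs => ?_
        simp only [happ _ _ hs]
        have h1 := hmeas Set.univ MeasurableSet.univ
        simp only [Set.univ_inter] at h1
        exact h1.inv.mul (hmeas s hs) }
  have hS : ∀ x, S x = (h (Metric.ball x δ))⁻¹ • h.restrict (Metric.ball x δ) := fun _ => rfl
  -- The density bound must be uniform: every δ-ball contains one of finitely many balls of radius δ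
  -- / 2, so the sum `D` of their inverse masses works.
  obtain ⟨t, -, htf, ht⟩ := finite_cover_balls_of_compact (isCompact_univ (X := X)) (half_pos hδ)
  have hpos' : ∀ x, h (Metric.ball x (δ / 2)) ≠ 0 := fun x =>
    (Metric.isOpen_ball.measure_pos h ⟨x, Metric.mem_ball_self (half_pos hδ)⟩).ne'
  set D : ℝ≥0∞ := ∑ i ∈ htf.toFinset, (h (Metric.ball i (δ / 2)))⁻¹ with hD
  have hDt : D ≠ ∞ := ENNReal.sum_ne_top.2 fun i _ => ENNReal.inv_ne_top.2 (hpos' i)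
  have hbound : ∀ x, (h (Metric.ball x δ))⁻¹ ≤ D := fun x => by
    obtain ⟨i, hi, hxi⟩ := Set.mem_iUnion₂.1 (ht (Set.mem_univ x))
    calc (h (Metric.ball x δ))⁻¹ ≤ (h (Metric.ball i (δ / 2)))⁻¹ := by
          refine ENNReal.inv_le_inv.2 (measure_mono (Metric.ball_subset_ball' ?_))
          have : dist i x < δ / 2 := by rw [dist_comm]; exact hxi
          linarith
      _ ≤ D := Finset.single_le_sum (f := fun i => (h (Metric.ball i (δ / 2)))⁻¹)
          (fun _ _ => zero_le) (htf.mem_toFinset.2 hi)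
  refine ⟨S, D.toNNReal, ⟨fun x => ⟨?_⟩⟩, fun x => ?_, fun x => ?_⟩
  · rw [hS, happ _ _ MeasurableSet.univ, Set.univ_inter,
      ENNReal.inv_mul_cancel (hpos x) (measure_ne_top _ _)]
  · refine Measure.le_iff.2 fun s hs => ?_
    rw [hS, happ _ _ hs, Measure.smul_apply, ENNReal.smul_def, ENNReal.coe_toNNReal hDt,
      smul_eq_mul]
    gcongr
    · exact hbound x
    · exact Set.inter_subset_left
  · rw [hS]
    refine Measure.ae_smul_measure ?_ _
    exact ae_restrict_mem measurableSet_ball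

/-- Measures of bounded density with respect to `h` which agree with `p` up to the truncation
level `n` and approximate it weakly. -/
theorem exists_bounded_density_approx (h p : ProbabilityMeasure X)
    (hsupp : (h : Measure X).IsOpenPosMeasure) :
    ∃ ps : ℕ → ProbabilityMeasure X,
      (∀ n, ∃ C : ℝ≥0, (ps n : Measure X) ≤ C • (h : Measure X)) ∧
      (∀ n : ℕ, (h : Measure X).withDensity
        (fun x => min ((p : Measure X).rnDeriv h x) n) ≤ ps n) ∧
      ∀ φ : C(X, ℝ≥0), Tendsto (fun n => ∫⁻ x, φ x ∂(ps n : Measure X)) atTop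
        (𝓝 (∫⁻ x, φ x ∂(p : Measure X))) := by
  have hδ : ∀ n : ℕ, (0 : ℝ) < 1 / (n + 1) := fun n => Nat.one_div_pos_of_nat
  choose S D hSM hSD hSd using fun n => exists_smoothing_kernel (h : Measure X) hsupp (hδ n)
  set g := (p : Measure X).rnDeriv h with hg
  -- Only the excess `R n` of `p` over this truncated part, singular part included, is smoothed.
  -- Keeping the truncated part intact preserves the lower density bounds that the comparison lemmas
  -- require.
  set m : ℕ → Measure X := fun n => (h : Measure X).withDensity (fun x => min (g x) n) with hm
  have hmp : ∀ n, m n ≤ p := fun n =>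
    (withDensity_mono (Eventually.of_forall fun x => min_le_left _ _)).trans
      (Measure.withDensity_rnDeriv_le _ _)
  have hmf : ∀ n, IsFiniteMeasure (m n) := fun n => isFiniteMeasure_of_le _ (hmp n)
  set R : ℕ → Measure X := fun n => p - m n with hR
  have hRm : ∀ n, R n + m n = p := fun n => Measure.sub_add_cancel_of_le (hmp n)
  have hRle : ∀ n, R n ≤ p := fun n => Measure.sub_le
  have hRf : ∀ n, IsFiniteMeasure (R n) := fun n => isFiniteMeasure_of_le _ (hRle n)
  have hsum : ∀ n (f : X → ℝ≥0∞), ∫⁻ x, f x ∂(R n) + ∫⁻ x, f x ∂(m n)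
      = ∫⁻ x, f x ∂(p : Measure X) := fun n f => by
    rw [← lintegral_add_measure, hRm]
  have hps : ∀ n, IsProbabilityMeasure (S n ∘ₘ R n + m n) := fun n => ⟨by
    have h1 : (S n ∘ₘ R n) Set.univ = R n Set.univ := by
      rw [Measure.bind_apply MeasurableSet.univ (Kernel.aemeasurable _)]
      simp
    rw [Measure.add_apply, h1, ← Measure.add_apply, hRm]
    exact measure_univ⟩
  refine ⟨fun n => ⟨S n ∘ₘ R n + m n, hps n⟩, fun n => ⟨D n + n, ?_⟩, fun n => ?_, fun φ => ?_⟩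
  · refine Measure.le_iff.2 fun s hs => ?_
    change (S n ∘ₘ R n) s + m n s ≤ ((D n + n : ℝ≥0) : ℝ≥0∞) * (h : Measure X) s
    rw [ENNReal.coe_add, add_mul]
    gcongr
    · rw [Measure.bind_apply hs (Kernel.aemeasurable _)]
      calc ∫⁻ x, S n x s ∂(R n) ≤ ∫⁻ _, D n * (h : Measure X) s ∂(R n) :=
            lintegral_mono fun x => hSD n x s
        _ = D n * (h : Measure X) s * R n Set.univ := lintegral_const _
        _ ≤ D n * (h : Measure X) s * 1 := by
            gcongr
            exact (hRle n _).trans (by simp)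
        _ = _ := mul_one _
    · rw [hm, withDensity_apply _ hs]
      calc ∫⁻ x in s, min (g x) n ∂(h : Measure X) ≤ ∫⁻ _ in s, (n : ℝ≥0∞) ∂(h : Measure X) :=
            lintegral_mono fun x => min_le_right _ _
        _ = _ := by rw [setLIntegral_const]; simp
  · exact Measure.le_add_left le_rfl
  · have hφm : Measurable fun x => (φ x : ℝ≥0∞) := φ.continuous.measurable.coe_nnreal_ennreal
    have hpt : ∫⁻ x, φ x ∂(p : Measure X) ≠ ∞ :=
      (BoundedContinuousFunction.lintegral_lt_top_of_nnreal (p : Measure X)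
        (BoundedContinuousFunction.mkOfCompact φ)).ne
    refine (ENNReal.tendsto_nhds hpt).2 fun ε hε => ?_
    obtain ⟨η, hη0, hηε⟩ := ENNReal.lt_iff_exists_nnreal_btwn.1 hε
    have hη : (0 : ℝ) < η := by exact_mod_cast hη0
    obtain ⟨δ, hδ0, hunif⟩ := Metric.uniformContinuous_iff.1
      (CompactSpace.uniformContinuous_of_continuous φ.continuous) η hη
    have hev := tendsto_one_div_add_atTop_nhds_zero_nat (𝕜 := ℝ) |>.eventually_lt_const hδ0
    filter_upwards [hev] with n hn
    have hclose : ∀ x, ∀ᵐ z ∂(S n x), (φ z : ℝ≥0∞) ≤ φ x + η ∧ (φ x : ℝ≥0∞) ≤ φ z + η := by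
      intro x
      filter_upwards [hSd n x] with z hz
      have h1 := hunif (hz.trans hn)
      rw [NNReal.dist_eq, abs_lt] at h1
      constructor
      · have : φ z ≤ φ x + η := by
          rw [← NNReal.coe_le_coe]; push_cast; linarith [h1.2]
        exact_mod_cast this
      · have : φ x ≤ φ z + η := by
          rw [← NNReal.coe_le_coe]; push_cast; linarith [h1.1]
        exact_mod_cast this
    have hR1 : R n Set.univ ≤ 1 := (hRle n _).trans (by simp)
    have hSint : ∫⁻ x, φ x ∂(S n ∘ₘ R n) = ∫⁻ x, ∫⁻ z, φ z ∂(S n x) ∂(R n) :=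
      Measure.lintegral_bind (Kernel.aemeasurable _) hφm.aemeasurable
    have hub : ∫⁻ x, φ x ∂(S n ∘ₘ R n) ≤ ∫⁻ x, φ x ∂(R n) + η := by
      rw [hSint]
      calc ∫⁻ x, ∫⁻ z, φ z ∂(S n x) ∂(R n) ≤ ∫⁻ x, (φ x + η) ∂(R n) := by
            refine lintegral_mono fun x => ?_
            calc ∫⁻ z, φ z ∂(S n x) ≤ ∫⁻ _, (φ x + η) ∂(S n x) :=
                  lintegral_mono_ae ((hclose x).mono fun z hz => hz.1)
              _ = _ := by simp
        _ = ∫⁻ x, φ x ∂(R n) + η * R n Set.univ := by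
            rw [lintegral_add_left hφm, lintegral_const]
        _ ≤ ∫⁻ x, φ x ∂(R n) + η * 1 := by gcongr
        _ = _ := by rw [mul_one]
    have hlb : ∫⁻ x, φ x ∂(R n) ≤ ∫⁻ x, φ x ∂(S n ∘ₘ R n) + η := by
      rw [hSint]
      calc ∫⁻ x, φ x ∂(R n) ≤ ∫⁻ x, (∫⁻ z, φ z ∂(S n x) + η) ∂(R n) := by
            refine lintegral_mono fun x => ?_
            calc (φ x : ℝ≥0∞) = ∫⁻ _, φ x ∂(S n x) := by simp
              _ ≤ ∫⁻ z, (φ z + η) ∂(S n x) :=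
                  lintegral_mono_ae ((hclose x).mono fun z hz => hz.2)
              _ = _ := by rw [lintegral_add_left hφm]; simp
        _ = ∫⁻ x, ∫⁻ z, φ z ∂(S n x) ∂(R n) + η * R n Set.univ := by
            rw [lintegral_add_right _ measurable_const, lintegral_const]
        _ ≤ ∫⁻ x, ∫⁻ z, φ z ∂(S n x) ∂(R n) + η * 1 := by gcongr
        _ = _ := by rw [mul_one]
    have hpn : ∫⁻ x, φ x ∂(S n ∘ₘ R n + m n)
        = ∫⁻ x, φ x ∂(S n ∘ₘ R n) + ∫⁻ x, φ x ∂(m n) := lintegral_add_measure _ _ _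
    change ∫⁻ x, φ x ∂(S n ∘ₘ R n + m n) ∈ _
    rw [hpn, ← hsum n]
    constructor
    · rw [tsub_le_iff_right]
      calc _ ≤ (∫⁻ x, φ x ∂(S n ∘ₘ R n) + η) + ∫⁻ x, φ x ∂(m n) := by gcongr
        _ = (∫⁻ x, φ x ∂(S n ∘ₘ R n) + ∫⁻ x, φ x ∂(m n)) + η := by ring
        _ ≤ _ := by gcongr
    · calc _ ≤ (∫⁻ x, φ x ∂(R n) + η) + ∫⁻ x, φ x ∂(m n) := by gcongr
        _ = (∫⁻ x, φ x ∂(R n) + ∫⁻ x, φ x ∂(m n)) + η := by ring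
        _ ≤ _ := by gcongr

end Smoothing

/-! ### Reduction to bounded densities, and convergence of the objective for positive λ. -/

section Approximation

theorem le_inv_smul_of_smul_le {A : Type*} [MeasurableSpace A] {ν ν' : Measure A} {ε : ℝ≥0}
    (hε : ε ≠ 0) (h : ε • ν ≤ ν') : ν ≤ ε⁻¹ • ν' := by
  intro s
  have h2 := h s
  simp only [Measure.smul_apply, ENNReal.smul_def, smul_eq_mul] at h2 ⊢
  calc ν s = ((ε⁻¹ : ℝ≥0) : ℝ≥0∞) * (ε * ν s) := by
        rw [← mul_assoc, ← ENNReal.coe_mul, inv_mul_cancel₀ hε, ENNReal.coe_one, one_mul]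
    _ ≤ _ := by gcongr

theorem toNNReal_smul_le_mix_left {X : Type*} [MeasurableSpace X] (t : unitInterval)
    (μ μ' : ProbabilityMeasure X) :
    (t : ℝ).toNNReal • (μ : Measure X) ≤ (mix t μ μ' : Measure X) := by
  rw [coe_mix]
  exact Measure.le_add_right le_rfl

theorem toNNReal_smul_le_mix_right {X : Type*} [MeasurableSpace X] (t : unitInterval)
    (μ μ' : ProbabilityMeasure X) :
    (1 - (t : ℝ)).toNNReal • (μ' : Measure X) ≤ (mix t μ μ' : Measure X) := by
  rw [coe_mix]
  exact Measure.le_add_left le_rfl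

theorem exists_unitInterval_mul_add_lt {a b c : ℝ≥0∞} (ha : a ≠ ∞) (hbc : b < c) :
    ∃ t : unitInterval, 0 < (t : ℝ) ∧ ENNReal.ofReal (t : ℝ) * a + b < c := by
  have h1 : Tendsto (fun n : ℕ => ENNReal.ofReal (1 / ((n : ℝ) + 1)) * a + b) atTop
      (𝓝 (ENNReal.ofReal 0 * a + b)) :=
    (ENNReal.Tendsto.mul_const (ENNReal.tendsto_ofReal tendsto_one_div_add_atTop_nhds_zero_nat)
      (Or.inr ha)).add_const b
  rw [ENNReal.ofReal_zero, zero_mul, zero_add] at h1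
  obtain ⟨n, hn⟩ := (h1.eventually_lt_const hbc).exists
  have h0 : (0 : ℝ) < 1 / (n + 1) := Nat.one_div_pos_of_nat
  exact ⟨⟨1 / (n + 1), h0.le, div_le_one_of_le₀ (by simp) (by positivity)⟩, h0, hn⟩

variable {X Y : Type*} [MeasurableSpace X] [MeasurableSpace Y] {ν : Measure Y} [SigmaFinite ν]
  (r : CorruptionDensity X Y ν)

theorem corrupt_le_smul {p p' : ProbabilityMeasure X} {C : ℝ≥0}
    (h : (p : Measure X) ≤ C • (p' : Measure X)) :
    (corrupt r p : Measure Y) ≤ C • (corrupt r p' : Measure Y) := by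
  change ν.withDensity (corruptDensity r p) ≤ (C : ℝ≥0∞) • ν.withDensity (corruptDensity r p')
  rw [← withDensity_smul _ (measurable_corruptDensity r p')]
  refine withDensity_mono (Eventually.of_forall fun y => ?_)
  calc corruptDensity r p y ≤ ∫⁻ x, r.density x y ∂((C : ℝ≥0∞) • (p' : Measure X)) :=
        lintegral_mono' h le_rfl
    _ = _ := by rw [lintegral_smul_measure]; rfl

theorem objective_prior_ne_top (pdata h : ProbabilityMeasure X)
    (hfin : KL (corrupt r pdata) (corrupt r h) ≠ ∞) (lam : ℝ≥0) :
    objective r pdata h lam h ≠ ∞ := by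
  rw [objective, KL_eq_zero_iff.2 (rfl : h = h), mul_zero, add_zero]
  exact hfin

variable [TopologicalSpace X] [CompactSpace X]

theorem llr_corrupt (hr : ∀ y, Continuous fun x => r.density x y) (p h : ProbabilityMeasure X) :
    llr (corrupt r p : Measure Y) (corrupt r h : Measure Y) =ᵐ[(corrupt r h : Measure Y)]
      fun y => Real.log (corruptDensity r p y / corruptDensity r h y).toReal := by
  have h1 : (corrupt r p : Measure Y) = (corrupt r h : Measure Y).withDensity
      (fun y => corruptDensity r p y / corruptDensity r h y) :=
    withDensity_corruptDensity_eq r hr p h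
  filter_upwards [Measure.rnDeriv_withDensity (corrupt r h : Measure Y)
    ((measurable_corruptDensity r p).div (measurable_corruptDensity r h))] with y hy
  rw [llr, h1]
  exact congrArg (fun z => Real.log (ENNReal.toReal z)) hy

variable [TopologicalSpace.MetrizableSpace X] [BorelSpace X]

/-- The bound p ≥ ε h survives truncation, so both divergences are upper semicontinuous along the
approximants. For the prior term the truncation eventually exceeds dp/dh at almost every point; for
the fit term weak convergence gives pointwise convergence of the corrupted densities. -/
theorem exists_bounded_density_objective_lt_of_le
    (hr : ∀ y, Continuous fun x => r.density x y) (pdata h : ProbabilityMeasure X)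
    (hsupp : (h : Measure X).IsOpenPosMeasure)
    (hfin : KL (corrupt r pdata) (corrupt r h) ≠ ∞) (lam : ℝ≥0) (p : ProbabilityMeasure X)
    {ε : ℝ≥0} (hε : ε ≠ 0) (hε1 : ε ≤ 1) (hp : ε • (h : Measure X) ≤ (p : Measure X))
    {c : ℝ≥0∞} (hc : objective r pdata h lam p < c) :
    ∃ p' : ProbabilityMeasure X, (∃ C : ℝ≥0, (p' : Measure X) ≤ C • (h : Measure X)) ∧
      objective r pdata h lam p' < c := by
  let _ := TopologicalSpace.metrizableSpaceMetric X
  obtain ⟨ps, hpsC, hpsl, hpst⟩ := exists_bounded_density_approx h p hsupp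
  have hC : (h : Measure X) ≤ ε⁻¹ • (p : Measure X) := le_inv_smul_of_smul_le hε hp
  have hg : ∀ᵐ x ∂(h : Measure X), (ε : ℝ≥0∞) ≤ (p : Measure X).rnDeriv h x :=
    le_rnDeriv_of_withDensity_le measurable_const (by rw [withDensity_const]; exact hp)
  -- The shift to index n + 1 keeps the truncation level at least 1 ≥ ε, so the lower bound is not
  -- cut.
  have hCs : ∀ n : ℕ, (h : Measure X) ≤ ε⁻¹ • (ps (n + 1) : Measure X) := fun n => by
    refine le_inv_smul_of_smul_le hε (le_trans ?_ (hpsl (n + 1)))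
    have h1 : (ε • (h : Measure X) : Measure X)
        = (h : Measure X).withDensity fun _ => (ε : ℝ≥0∞) := (withDensity_const _).symm
    rw [h1]
    refine withDensity_mono ?_
    filter_upwards [hg] with x hx
    refine le_min hx ?_
    calc (ε : ℝ≥0∞) ≤ 1 := by exact_mod_cast hε1
      _ ≤ ((n + 1 : ℕ) : ℝ≥0∞) := by exact_mod_cast Nat.le_add_left 1 n
  have hKh : ∀ c' : ℝ≥0∞, KL h p < c' → ∀ᶠ n in atTop, KL h (ps (n + 1)) < c' := by
    intro c' hc'
    refine eventually_klDiv_lt (μ := (h : Measure X)) (ν := h) (ν' := p)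
      (νs := fun n => ps (n + 1)) (by simp) hC (fun n => inferInstance) hCs ?_ hc'
    have hall : ∀ᵐ x ∂(h : Measure X), ∀ n : ℕ,
        min ((p : Measure X).rnDeriv h x) ((n + 1 : ℕ) : ℝ≥0∞) ≠ 0 →
        Real.log (min ((p : Measure X).rnDeriv h x) ((n + 1 : ℕ) : ℝ≥0∞)).toReal
          ≤ llr (ps (n + 1) : Measure X) h x := by
      refine ae_all_iff.2 fun n => log_le_llr_of_withDensity_le (by fun_prop)
        (Eventually.of_forall fun x => ?_) (hpsl (n + 1))
      exact ne_top_of_le_ne_top (ENNReal.natCast_ne_top _) (min_le_right _ _)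
    filter_upwards [hall, hg, Measure.rnDeriv_lt_top (p : Measure X) h] with x h1 h2 h3 b hb
    obtain ⟨N, hN⟩ := ENNReal.exists_nat_gt h3.ne
    filter_upwards [eventually_ge_atTop N] with n hn
    have h4 : min ((p : Measure X).rnDeriv h x) ((n + 1 : ℕ) : ℝ≥0∞)
        = (p : Measure X).rnDeriv h x := by
      refine min_eq_left (hN.le.trans ?_)
      exact_mod_cast hn.trans (Nat.le_succ n)
    have h5 := h1 n
    rw [h4] at h5
    refine hb.le.trans (h5 fun h0 => hε ?_)
    rw [h0] at h2
    simpa using h2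
  have hKq : ∀ c' : ℝ≥0∞, KL (corrupt r pdata) (corrupt r p) < c' →
      ∀ᶠ n in atTop, KL (corrupt r pdata) (corrupt r (ps (n + 1))) < c' := by
    intro c' hc'
    refine eventually_klDiv_lt (μ := (corrupt r pdata : Measure Y)) (ν := corrupt r h)
      (ν' := corrupt r p) (νs := fun n => corrupt r (ps (n + 1))) hfin (corrupt_le_smul r hC)
      (fun n => inferInstance) (fun n => corrupt_le_smul r (hCs n)) ?_ hc'
    have hac : (corrupt r pdata : Measure Y) ≪ corrupt r h := (klDiv_ne_top_iff.1 hfin).1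
    refine hac.ae_le ?_
    have hall := ae_all_iff.2 fun n : ℕ => llr_corrupt r hr (ps (n + 1)) h
    filter_upwards [hall, llr_corrupt r hr p h] with y h1 h2 b hb
    have h0 := corruptDensity_ne_zero r h y
    have ht := corruptDensity_ne_top r hr h y
    have h3 : Tendsto (fun n => corruptDensity r (ps (n + 1)) y) atTop
        (𝓝 (corruptDensity r p y)) :=
      (hpst ⟨fun x => r.density x y, hr y⟩).comp (tendsto_add_atTop_nat 1)
    have h4 := (ENNReal.tendsto_toReal (ENNReal.div_ne_top (corruptDensity_ne_top r hr p y)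
      h0)).comp (ENNReal.Tendsto.div_const h3 (Or.inr h0))
    have h5 := h4.log (ENNReal.toReal_pos (ENNReal.div_pos (corruptDensity_ne_zero r p y) ht).ne'
      (ENNReal.div_ne_top (corruptDensity_ne_top r hr p y) h0)).ne'
    rw [h2] at hb
    filter_upwards [h5.eventually_const_lt hb] with n hn
    rw [h1 n]
    exact hn.le
  have hK2 : KL h p ≠ ∞ := klDiv_ne_top_of_le_smul (μ := (h : Measure X)) (ν := h) (by simp) hC
  have hK1 : KL (corrupt r pdata) (corrupt r p) ≠ ∞ :=
    klDiv_ne_top_of_le_smul hfin (corrupt_le_smul r hC)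
  have hs : Tendsto (fun n : ℕ => (KL (corrupt r pdata) (corrupt r p) + (n : ℝ≥0∞)⁻¹)
      + lam * (KL h p + (n : ℝ≥0∞)⁻¹)) atTop
      (𝓝 ((KL (corrupt r pdata) (corrupt r p) + 0) + lam * (KL h p + 0))) :=
    (ENNReal.tendsto_inv_nat_nhds_zero.const_add _).add
      (ENNReal.Tendsto.const_mul (ENNReal.tendsto_inv_nat_nhds_zero.const_add _)
        (Or.inr ENNReal.coe_ne_top))
  simp only [add_zero] at hs
  obtain ⟨n, hn⟩ := (hs.eventually_lt_const hc).exists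
  have hn0 : (n : ℝ≥0∞)⁻¹ ≠ 0 := ENNReal.inv_ne_zero.2 (ENNReal.natCast_ne_top n)
  obtain ⟨k, hk1, hk2⟩ := ((hKq _ (ENNReal.lt_add_right hK1 hn0)).and
    (hKh _ (ENNReal.lt_add_right hK2 hn0))).exists
  refine ⟨ps (k + 1), hpsC _, lt_of_le_of_lt ?_ hn⟩
  exact add_le_add hk1.le (mul_le_mul_right hk2.le _)

/-- The infimum of the objective is not changed by restricting it to measures of bounded density
with respect to the prior. -/
theorem exists_bounded_density_objective_lt
    (hr : ∀ y, Continuous fun x => r.density x y) (pdata h : ProbabilityMeasure X)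
    (hsupp : (h : Measure X).IsOpenPosMeasure)
    (hfin : KL (corrupt r pdata) (corrupt r h) ≠ ∞) (lam : ℝ≥0) (p : ProbabilityMeasure X)
    {c : ℝ≥0∞} (hc : objective r pdata h lam p < c) :
    ∃ p' : ProbabilityMeasure X, (∃ C : ℝ≥0, (p' : Measure X) ≤ C • (h : Measure X)) ∧
      objective r pdata h lam p' < c := by
  -- Mixing a little `h` into `p` provides the lower bound t h; by convexity it costs at most t
  -- J_λ(h), which is finite.
  obtain ⟨t, ht0, ht⟩ := exists_unitInterval_mul_add_lt
    (objective_prior_ne_top r pdata h hfin lam) hc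
  refine exists_bounded_density_objective_lt_of_le r hr pdata h hsupp hfin lam (mix t h p)
    (ε := (t : ℝ).toNNReal) (Real.toNNReal_pos.2 ht0).ne' (Real.toNNReal_le_one.2 t.2.2)
    (toNNReal_smul_le_mix_left t h p) (lt_of_le_of_lt (objective_mix_le r pdata h lam t h p) ?_)
  refine lt_of_le_of_lt ?_ ht
  gcongr
  calc ENNReal.ofReal (1 - (t : ℝ)) * objective r pdata h lam p
      ≤ 1 * objective r pdata h lam p := by
        gcongr
        exact ENNReal.ofReal_le_one.2 (by linarith)
    _ = _ := one_mul _

/-- For `lam > 0` the objective converges along the iteration to its infimum. -/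
theorem eventually_objective_iterate_lt_of_pos
    (hr : ∀ y, Continuous fun x => r.density x y) (pdata h : ProbabilityMeasure X)
    (hsupp : (h : Measure X).IsOpenPosMeasure)
    (hfin : KL (corrupt r pdata) (corrupt r h) ≠ ∞) {γ : unitInterval} (hγ : 0 < γ)
    (p0 : ProbabilityMeasure X) {lam : ℝ≥0} (hlam : 0 < lam) (p : ProbabilityMeasure X)
    {c : ℝ≥0∞} (hc : objective r pdata h lam p < c) :
    ∀ᶠ k in atTop, objective r pdata h lam (iterate r pdata h γ p0 lam k) < c := by
  obtain ⟨p', ⟨C, hC⟩, hp'⟩ :=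
    exists_bounded_density_objective_lt r hr pdata h hsupp hfin lam p hc
  have hT := corruptDensity_ne_top r hr
  refine eventually_objective_iterate_lt r pdata h γ p0 lam hT hγ p' ?_ hp'
  rw [iterate_one]
  -- The exact step from p' has finite divergence from p', and p' ≤ C h is dominated by a multiple
  -- of p^1, whose share of `h` is positive because λ > 0.
  have h1 : KL (exactStep r pdata h lam p') p' ≠ ∞ :=
    ne_top_of_le_ne_top (ENNReal.mul_ne_top ENNReal.ofReal_ne_top hp'.ne_top)
      (KL_exactStep_le r pdata h hT lam p')
  have hw : 0 < 1 - (dataWeight lam : ℝ) := by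
    have h2 : (1 : ℝ) / (1 + lam) < 1 := by
      rw [div_lt_one (by positivity)]
      have : (0 : ℝ) < lam := by exact_mod_cast hlam
      linarith
    exact sub_pos.2 h2
  have h3 : (h : Measure X) ≤ (1 - (dataWeight lam : ℝ)).toNNReal⁻¹ •
      (exactStep r pdata h lam p0 : Measure X) :=
    le_inv_smul_of_smul_le (Real.toNNReal_pos.2 hw).ne' (toNNReal_smul_le_mix_right _ _ _)
  refine klDiv_ne_top_of_le_smul (C := C * (1 - (dataWeight lam : ℝ)).toNNReal⁻¹) h1
    (hC.trans ?_)
  rw [mul_smul]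
  intro s
  simp only [Measure.smul_apply]
  gcongr
  exact h3 s

end Approximation

/-! ### Strict convexity of the prior divergence. -/

section Uniqueness

variable {X : Type*} [MeasurableSpace X]

/-- The weight `1 / 2`. -/
noncomputable def half : unitInterval := ⟨1 / 2, by norm_num, by norm_num⟩

theorem ofReal_half : ENNReal.ofReal (half : ℝ) = 2⁻¹ := by
  change ENNReal.ofReal (1 / 2) = _
  rw [one_div, ENNReal.ofReal_inv_of_pos (by norm_num)]
  simp

theorem ofReal_one_sub_half : ENNReal.ofReal (1 - (half : ℝ)) = 2⁻¹ := by
  change ENNReal.ofReal (1 - 1 / 2) = _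
  rw [← ofReal_half]
  change _ = ENNReal.ofReal (1 / 2)
  norm_num

/-- Strict convexity of `KL h` at measures which are absolutely continuous with respect to `h`. -/
theorem eq_of_half_add_half_le_KL {h p b : ProbabilityMeasure X}
    (hp : (p : Measure X) ≪ (h : Measure X)) (hpf : KL h p ≠ ∞) (hbf : KL h b ≠ ∞)
    (hle : 2⁻¹ * KL h p + 2⁻¹ * KL h b ≤ KL h (mix half p b)) : b = p := by
  set m := mix half p b with hm
  have hmf : KL h m ≠ ∞ := by
    refine ne_top_of_le_ne_top ?_ (KL_mix_right_le half h p b)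
    exact ENNReal.add_ne_top.2 ⟨ENNReal.mul_ne_top ENNReal.ofReal_ne_top hpf,
      ENNReal.mul_ne_top ENNReal.ofReal_ne_top hbf⟩
  obtain ⟨hap, hip⟩ := klDiv_ne_top_iff.1 hpf
  obtain ⟨hab, hib⟩ := klDiv_ne_top_iff.1 hbf
  obtain ⟨ham, him⟩ := klDiv_ne_top_iff.1 hmf
  have hrp : (KL h p).toReal = ∫ x, llr (h : Measure X) p x ∂(h : Measure X) :=
    toReal_klDiv_of_measure_eq hap (by simp)
  have hrb : (KL h b).toReal = ∫ x, llr (h : Measure X) b x ∂(h : Measure X) :=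
    toReal_klDiv_of_measure_eq hab (by simp)
  have hrm : (KL h m).toReal = ∫ x, llr (h : Measure X) m x ∂(h : Measure X) :=
    toReal_klDiv_of_measure_eq ham (by simp)
  have hreal : 2⁻¹ * (KL h p).toReal + 2⁻¹ * (KL h b).toReal ≤ (KL h m).toReal := by
    have h1 := ENNReal.toReal_mono hmf hle
    rw [ENNReal.toReal_add (ENNReal.mul_ne_top (by simp) hpf) (ENNReal.mul_ne_top (by simp) hbf),
      ENNReal.toReal_mul, ENNReal.toReal_mul] at h1
    simpa using h1
  -- The pointwise midpoint gap of -log at the two densities: nonnegative, and zero only where they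
  -- agree. The hypothesis forces its integral to be at most zero.
  set F : X → ℝ := fun x => (2⁻¹ * llr (h : Measure X) p x + 2⁻¹ * llr (h : Measure X) b x)
    - llr (h : Measure X) m x with hF
  have hFi : Integrable F h := ((hip.const_mul _).add (hib.const_mul _)).sub him
  have hFint : ∫ x, F x ∂(h : Measure X) ≤ 0 := by
    have h2 : ∫ x, F x ∂(h : Measure X)
        = 2⁻¹ * (KL h p).toReal + 2⁻¹ * (KL h b).toReal - (KL h m).toReal := by
      have h3 : Integrable (fun x => 2⁻¹ * llr (h : Measure X) p x
        + 2⁻¹ * llr (h : Measure X) b x) h := (hip.const_mul _).add (hib.const_mul _)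
      rw [hrp, hrb, hrm, ← integral_const_mul, ← integral_const_mul,
        ← integral_add (hip.const_mul _) (hib.const_mul _), ← integral_sub h3 him]
    linarith
  have hmd : (m : Measure X).rnDeriv h =ᵐ[(h : Measure X)]
      fun x => 2⁻¹ * (p : Measure X).rnDeriv h x + 2⁻¹ * (b : Measure X).rnDeriv h x := by
    have e : (m : Measure X) = (2⁻¹ : ℝ≥0) • (p : Measure X) + (2⁻¹ : ℝ≥0) • (b : Measure X) := by
      have h2 : ((2⁻¹ : ℝ≥0) : ℝ≥0∞) = 2⁻¹ := by simp
      rw [hm, coe_mix, ofReal_half, ofReal_one_sub_half, ← h2]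
      rfl
    rw [e]
    filter_upwards [Measure.rnDeriv_add' ((2⁻¹ : ℝ≥0) • (p : Measure X))
      ((2⁻¹ : ℝ≥0) • (b : Measure X)) (h : Measure X),
      Measure.rnDeriv_smul_left' (p : Measure X) (h : Measure X) (2⁻¹ : ℝ≥0),
      Measure.rnDeriv_smul_left' (b : Measure X) (h : Measure X) (2⁻¹ : ℝ≥0)] with x h1 h2 h3
    rw [h1, Pi.add_apply, h2, h3]
    simp [ENNReal.smul_def]
  have hkey : ∀ᵐ x ∂(h : Measure X), 0 ≤ F x ∧
      (F x = 0 → (p : Measure X).rnDeriv h x = (b : Measure X).rnDeriv h x) := by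
    filter_upwards [hmd, neg_llr hap, neg_llr hab, neg_llr ham, Measure.rnDeriv_pos' hap,
      Measure.rnDeriv_pos' hab, Measure.rnDeriv_lt_top (p : Measure X) h,
      Measure.rnDeriv_lt_top (b : Measure X) h] with x e np nb nm pp pb tp tb
    rw [Pi.neg_apply] at np nb nm
    set u := ((p : Measure X).rnDeriv h x).toReal with hu
    set v := ((b : Measure X).rnDeriv h x).toReal with hv
    have hu0 : 0 < u := ENNReal.toReal_pos pp.ne' tp.ne
    have hv0 : 0 < v := ENNReal.toReal_pos pb.ne' tb.ne
    have e' : ((m : Measure X).rnDeriv h x).toReal = 2⁻¹ * u + 2⁻¹ * v := by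
      rw [e, ENNReal.toReal_add (ENNReal.mul_ne_top (by simp) tp.ne)
        (ENNReal.mul_ne_top (by simp) tb.ne), ENNReal.toReal_mul, ENNReal.toReal_mul]
      simp [hu, hv]
    have hFx : F x = Real.log (2⁻¹ * u + 2⁻¹ * v) - (2⁻¹ * Real.log u + 2⁻¹ * Real.log v) := by
      have h1 : llr (h : Measure X) p x = -Real.log u := by rw [hu]; simp only [llr] at np ⊢; linarith
      have h2 : llr (h : Measure X) b x = -Real.log v := by rw [hv]; simp only [llr] at nb ⊢; linarith
      have h3 : llr (h : Measure X) m x = -Real.log (2⁻¹ * u + 2⁻¹ * v) := by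
        rw [← e']; simp only [llr] at nm ⊢; linarith
      simp only [hF]
      rw [h1, h2, h3]
      ring
    have hsc := strictConcaveOn_log_Ioi
    refine ⟨?_, fun hF0 => ?_⟩
    · have := hsc.concaveOn.2 (Set.mem_Ioi.2 hu0) (Set.mem_Ioi.2 hv0)
        (show (0 : ℝ) ≤ 2⁻¹ by norm_num) (show (0 : ℝ) ≤ 2⁻¹ by norm_num) (by norm_num)
      simp only [smul_eq_mul] at this
      rw [hFx]
      linarith
    · by_contra hne
      have huv : u ≠ v := fun huv => hne ((ENNReal.toReal_eq_toReal_iff' tp.ne tb.ne).1 huv)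
      have := hsc.2 (Set.mem_Ioi.2 hu0) (Set.mem_Ioi.2 hv0) huv
        (show (0 : ℝ) < 2⁻¹ by norm_num) (show (0 : ℝ) < 2⁻¹ by norm_num) (by norm_num)
      simp only [smul_eq_mul] at this
      rw [hFx] at hF0
      linarith
  have hF0 : ∀ᵐ x ∂(h : Measure X), F x = 0 := by
    have h1 : ∫ x, F x ∂(h : Measure X) = 0 :=
      le_antisymm hFint (integral_nonneg_of_ae (hkey.mono fun x hx => hx.1))
    exact (integral_eq_zero_iff_of_nonneg_ae (hkey.mono fun x hx => hx.1) hFi).1 h1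
  have hd : (p : Measure X).rnDeriv h =ᵐ[(h : Measure X)] (b : Measure X).rnDeriv h := by
    filter_upwards [hkey, hF0] with x h1 h2 using h1.2 h2
  -- Equal densities still allow `b` a part singular to `h`. Since p ≪ h, `p` is the absolutely
  -- continuous part of `b`, and equal total mass excludes the rest.
  have hpb : (p : Measure X) ≤ b := by
    rw [← Measure.withDensity_rnDeriv_eq _ _ hp, withDensity_congr_ae hd]
    exact Measure.withDensity_rnDeriv_le _ _
  exact Subtype.ext (Measure.eq_of_le_of_measure_univ_eq hpb (by simp)).symm

end Uniqueness

/-! ### Minimizers and minimizing sequences on compact spaces. -/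

section Compactness

/-- On a compact space, a sequence along which a lower semicontinuous function falls below all of
its values ends up in every open set which contains all minimizers. -/
theorem eventually_mem_of_isMinimizer_mem {P : Type*} [TopologicalSpace P] [CompactSpace P]
    {f : P → ℝ≥0∞} (hf : LowerSemicontinuous f) {U : Set P} (hU : IsOpen U)
    (hmin : ∀ b, IsMinimizer f Set.univ b → b ∈ U) {x : ℕ → P}
    (hx : ∀ p c, f p < c → ∀ᶠ k in atTop, f (x k) < c) : ∀ᶠ k in atTop, x k ∈ U := by
  rcases Uᶜ.eq_empty_or_nonempty with hE | hE
  · rw [Set.compl_empty_iff] at hE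
    simp [hE]
  -- The best point outside `U` is not a global minimizer, so something lies strictly below it and
  -- the sequence eventually falls below it too.
  obtain ⟨b, hb, hbmin⟩ :=
    (hf.lowerSemicontinuousOn Uᶜ).exists_isMinOn hE hU.isClosed_compl.isCompact
  have h1 : ¬ IsMinimizer f Set.univ b := fun h => hb (hmin b h)
  have h2 : ∃ p, f p < f b := by
    by_contra! hcon
    exact h1 ⟨Set.mem_univ b, fun p _ => hcon p⟩
  obtain ⟨p, hp⟩ := h2
  filter_upwards [hx p _ hp] with k hk
  by_contra hkU
  exact absurd (hbmin hkU) (not_le.2 hk)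

theorem exists_isMinimizer {P : Type*} [TopologicalSpace P] [CompactSpace P] {f : P → ℝ≥0∞}
    (hf : LowerSemicontinuous f) {s : Set P} (hs : IsClosed s) (hne : s.Nonempty) :
    ∃ p, IsMinimizer f s p := by
  obtain ⟨b, hb, hbmin⟩ := (hf.lowerSemicontinuousOn s).exists_isMinOn hne hs.isCompact
  exact ⟨b, hb, fun p hp => hbmin hp⟩

end Compactness

/-! ### Uniqueness of minimizers and the limit of vanishing regularization. -/

section Regularized

variable {X Y : Type*} [MeasurableSpace X] [MeasurableSpace Y] {ν : Measure Y} [SigmaFinite ν]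
  (r : CorruptionDensity X Y ν) (pdata h : ProbabilityMeasure X)

theorem objective_zero (p : ProbabilityMeasure X) :
    objective r pdata h 0 p = KL (corrupt r pdata) (corrupt r p) := by
  simp [objective]

theorem mem_solutionSet_iff {p : ProbabilityMeasure X} :
    p ∈ solutionSet r pdata ↔ KL (corrupt r pdata) (corrupt r p) = 0 := by
  rw [KL_eq_zero_iff]
  exact eq_comm

/-- At the midpoint of two minimizers the fit is at most its average while J_λ is at least its
average. Cancelling the finite fit and the factor λ leaves the equality case of strict convexity for
`KL h`. -/
theorem isArgmin_objective_of_absolutelyContinuous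
    (hfin : KL (corrupt r pdata) (corrupt r h) ≠ ∞) {lam : ℝ≥0} (hlam : 0 < lam)
    {p : ProbabilityMeasure X} (hp : IsMinimizer (objective r pdata h lam) Set.univ p)
    (hac : (p : Measure X) ≪ (h : Measure X)) :
    IsArgmin (objective r pdata h lam) Set.univ p := by
  refine ⟨hp, fun b hb => ?_⟩
  have hl0 : (lam : ℝ≥0∞) ≠ 0 := by exact_mod_cast hlam.ne'
  have hJp : objective r pdata h lam p ≠ ∞ := ne_top_of_le_ne_top
    (objective_prior_ne_top r pdata h hfin lam) (hp.2 h (Set.mem_univ _))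
  have hJb : objective r pdata h lam b ≠ ∞ := ne_top_of_le_ne_top hJp (hb.2 p (Set.mem_univ _))
  have hKL : ∀ m : ProbabilityMeasure X, objective r pdata h lam m ≠ ∞ → KL h m ≠ ∞ := by
    intro m hm hcon
    refine hm ?_
    rw [objective, hcon, ENNReal.mul_top hl0, add_top]
  have hKq : ∀ m : ProbabilityMeasure X, objective r pdata h lam m ≠ ∞ →
      KL (corrupt r pdata) (corrupt r m) ≠ ∞ := fun m hm =>
    ne_top_of_le_ne_top hm le_self_add
  refine eq_of_half_add_half_le_KL hac (hKL p hJp) (hKL b hJb) ?_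
  set m := mix half p b
  have hq : KL (corrupt r pdata) (corrupt r m)
      ≤ 2⁻¹ * KL (corrupt r pdata) (corrupt r p) + 2⁻¹ * KL (corrupt r pdata) (corrupt r b) := by
    have h1 := KL_mix_right_le half (corrupt r pdata) (corrupt r p) (corrupt r b)
    rwa [← corrupt_mix, ofReal_half, ofReal_one_sub_half] at h1
  have hJ : 2⁻¹ * objective r pdata h lam p + 2⁻¹ * objective r pdata h lam b
      ≤ objective r pdata h lam m := by
    calc 2⁻¹ * objective r pdata h lam p + 2⁻¹ * objective r pdata h lam b
        ≤ 2⁻¹ * objective r pdata h lam m + 2⁻¹ * objective r pdata h lam m := by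
          gcongr
          · exact hp.2 m (Set.mem_univ _)
          · exact hb.2 m (Set.mem_univ _)
      _ = objective r pdata h lam m := by
          rw [← add_mul, ENNReal.inv_two_add_inv_two, one_mul]
  have hD : 2⁻¹ * KL (corrupt r pdata) (corrupt r p) + 2⁻¹ * KL (corrupt r pdata) (corrupt r b)
      ≠ ∞ := ENNReal.add_ne_top.2 ⟨ENNReal.mul_ne_top (by simp) (hKq p hJp),
        ENNReal.mul_ne_top (by simp) (hKq b hJb)⟩
  refine (ENNReal.mul_le_mul_iff_right hl0 ENNReal.coe_ne_top).1 ?_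
  refine (ENNReal.add_le_add_iff_left hD).1 ?_
  calc _ = 2⁻¹ * objective r pdata h lam p + 2⁻¹ * objective r pdata h lam b := by
        simp only [objective]; ring
    _ ≤ objective r pdata h lam m := hJ
    _ ≤ _ := by
        rw [objective]
        gcongr

/-- Since T_r is affine, midpoints remain in S(q), and strict convexity applies directly. -/
theorem isArgmin_KL_of_absolutelyContinuous {p : ProbabilityMeasure X}
    (hp : IsMinimizer (KL h) (solutionSet r pdata) p) (hpf : KL h p ≠ ∞)
    (hac : (p : Measure X) ≪ (h : Measure X)) :
    IsArgmin (KL h) (solutionSet r pdata) p := by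
  refine ⟨hp, fun b hb => ?_⟩
  refine eq_of_half_add_half_le_KL hac hpf (ne_top_of_le_ne_top hpf (hb.2 p hp.1)) ?_
  have hm : mix half p b ∈ solutionSet r pdata := by
    have h1 : corrupt r p = corrupt r pdata := hp.1
    have h2 : corrupt r b = corrupt r pdata := hb.1
    change corrupt r (mix half p b) = corrupt r pdata
    rw [corrupt_mix, h1, h2, mix_self]
  calc 2⁻¹ * KL h p + 2⁻¹ * KL h b
      ≤ 2⁻¹ * KL h (mix half p b) + 2⁻¹ * KL h (mix half p b) := by
        gcongr
        · exact hp.2 _ hm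
        · exact hb.2 _ hm
    _ = KL h (mix half p b) := by rw [← add_mul, ENNReal.inv_two_add_inv_two, one_mul]

theorem eventually_coe_mul_lt {V c : ℝ≥0∞} (hV : V ≠ ∞) (hc : 0 < c) :
    ∀ᶠ lam : ℝ≥0 in 𝓝[>] 0, (lam : ℝ≥0∞) * V < c := by
  have h1 : Tendsto (fun lam : ℝ≥0 => (lam : ℝ≥0∞) * V) (𝓝 0) (𝓝 (((0 : ℝ≥0) : ℝ≥0∞) * V)) :=
    ENNReal.Tendsto.mul_const (ENNReal.continuous_coe.tendsto 0) (Or.inr hV)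
  rw [ENNReal.coe_zero, zero_mul] at h1
  exact (h1.mono_left nhdsWithin_le_nhds).eventually_lt_const hc

variable [TopologicalSpace X] [CompactSpace X] [TopologicalSpace.MetrizableSpace X] [BorelSpace X]

theorem isClosed_solutionSet (hr : ∀ y, Continuous fun x => r.density x y) :
    IsClosed (solutionSet r pdata) := by
  have h1 : solutionSet r pdata
      = (fun p => KL (corrupt r pdata) (corrupt r p)) ⁻¹' Set.Iic 0 := by
    ext p
    rw [mem_solutionSet_iff]
    simp
  rw [h1]
  exact lowerSemicontinuous_iff_isClosed_preimage.1 (lowerSemicontinuous_KL_corrupt r hr pdata) 0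

/-- Minimizers of the objective are close to the projection of the prior when `lam` is small. -/
theorem eventually_isMinimizer_mem (hr : ∀ y, Continuous fun x => r.density x y)
    (hfin : KL (corrupt r pdata) (corrupt r h) ≠ ∞) {hdag : ProbabilityMeasure X}
    (hdagmin : IsArgmin (KL h) (solutionSet r pdata) hdag) {U : Set (ProbabilityMeasure X)}
    (hU : IsOpen U) (hdU : hdag ∈ U) :
    ∀ᶠ lam in 𝓝[>] (0 : ℝ≥0), ∀ b, IsMinimizer (objective r pdata h lam) Set.univ b → b ∈ U := by
  have hlsc := lowerSemicontinuous_KL_corrupt r hr pdata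
  have hdag0 : KL (corrupt r pdata) (corrupt r hdag) = 0 :=
    (mem_solutionSet_iff r pdata).1 hdagmin.1.1
  set f : ProbabilityMeasure X → ℝ≥0∞ := fun p => KL (corrupt r pdata) (corrupt r p) with hf
  -- On this compact set the fit has a positive lower bound m: a zero of it would be another
  -- minimizer over S(q), lying outside `U`.
  set K : Set (ProbabilityMeasure X) := Uᶜ ∩ KL h ⁻¹' Set.Iic (KL h hdag) with hK
  have hKc : IsClosed K := hU.isClosed_compl.inter
    (lowerSemicontinuous_iff_isClosed_preimage.1 (lowerSemicontinuous_KL_right h) _)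
  obtain ⟨m, hm0, hm⟩ : ∃ m : ℝ≥0∞, 0 < m ∧ ∀ b ∈ K, m ≤ f b := by
    rcases K.eq_empty_or_nonempty with hE | hE
    · exact ⟨1, one_pos, by simp [hE]⟩
    obtain ⟨b, hb, hbmin⟩ := (hlsc.lowerSemicontinuousOn K).exists_isMinOn hE hKc.isCompact
    refine ⟨f b, pos_iff_ne_zero.2 fun h0 => hb.1 ?_, fun p hp => hbmin hp⟩
    have h1 : IsMinimizer (KL h) (solutionSet r pdata) b :=
      ⟨(mem_solutionSet_iff r pdata).2 h0, fun p hp => le_trans hb.2 (hdagmin.1.2 p hp)⟩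
    rw [hdagmin.2 b h1]
    exact hdU
  -- An infinite value makes `hdag` useless as a competitor and `K` all of `Uᶜ`. A mixture with `h`
  -- then has finite prior divergence and fit below m, hence objective below m for small λ.
  by_cases hV : KL h hdag = ∞
  · have hf0 : f hdag < m := by rw [hf]; simpa only [hdag0] using hm0
    obtain ⟨t, ht0, ht⟩ := exists_unitInterval_mul_add_lt hfin hf0
    have hft : f (mix t h hdag) < m := by
      refine lt_of_le_of_lt ?_ ht
      have h1 := KL_mix_right_le t (corrupt r pdata) (corrupt r h) (corrupt r hdag)
      rw [← corrupt_mix, hdag0, mul_zero, add_zero] at h1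
      exact h1.trans le_self_add
    have hht : KL h (mix t h hdag) ≠ ∞ :=
      klDiv_ne_top_of_le_smul (μ := (h : Measure X)) (ν := h) (by simp)
        (le_inv_smul_of_smul_le (Real.toNNReal_pos.2 ht0).ne' (toNNReal_smul_le_mix_left t h hdag))
    filter_upwards [eventually_coe_mul_lt hht (tsub_pos_of_lt hft)] with lam hlam b hb
    by_contra hbU
    have h1 : m ≤ f b := hm b ⟨hbU, by simp [hV]⟩
    have h2 : objective r pdata h lam (mix t h hdag) < m := by
      rw [objective, add_comm]
      exact lt_tsub_iff_right.1 hlam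
    exact absurd ((h1.trans le_self_add).trans (hb.2 _ (Set.mem_univ _))) (not_le.2 h2)
  · filter_upwards [eventually_coe_mul_lt hV hm0, self_mem_nhdsWithin] with lam hlam hpos b hb
    by_contra hbU
    have hl0 : (lam : ℝ≥0∞) ≠ 0 := by exact_mod_cast (Set.mem_Ioi.1 hpos).ne'
    have h1 : objective r pdata h lam b ≤ lam * KL h hdag := by
      refine (hb.2 hdag (Set.mem_univ _)).trans (le_of_eq ?_)
      rw [objective, hdag0, zero_add]
    have h2 : KL h b ≤ KL h hdag :=
      (ENNReal.mul_le_mul_iff_right hl0 ENNReal.coe_ne_top).1 (le_add_self.trans h1)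
    exact absurd ((hm b ⟨hbU, h2⟩).trans (le_self_add.trans h1)) (not_le.2 hlam)

end Regularized

/-! ### The iteration without regularization. -/

section Unregularized

variable {X Y : Type*} [MeasurableSpace X] [MeasurableSpace Y] {ν : Measure Y} [SigmaFinite ν]
  (r : CorruptionDensity X Y ν) (pdata h : ProbabilityMeasure X) (γ : unitInterval)
  (p0 : ProbabilityMeasure X)

theorem ofReal_dataWeight_zero : ENNReal.ofReal (dataWeight 0 : ℝ) = 1 := by
  simp [dataWeight]

/-- The step moves `p` by a divergence of at most its fit, which vanishes on S(q). So `p` itself may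
replace its exact step in the telescoped estimates. -/
theorem exactStep_zero_of_mem (hT : ∀ (p : ProbabilityMeasure X) y, corruptDensity r p y ≠ ∞)
    {p : ProbabilityMeasure X} (hp : p ∈ solutionSet r pdata) : exactStep r pdata h 0 p = p := by
  have h1 := KL_exactStep_le r pdata h hT 0 p
  rw [objective_zero, (mem_solutionSet_iff r pdata).1 hp, mul_zero] at h1
  exact KL_eq_zero_iff.1 (le_antisymm h1 zero_le)

theorem KL_iterate_zero_succ_le
    (hT : ∀ (p : ProbabilityMeasure X) y, corruptDensity r p y ≠ ∞)
    {p : ProbabilityMeasure X} (hp : p ∈ solutionSet r pdata) (k : ℕ) :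
    KL p (iterate r pdata h γ p0 0 (k + 1)) ≤ KL p (iterate r pdata h γ p0 0 k) := by
  have hG := exactStep_zero_of_mem r pdata h hT hp
  have h0 : objective r pdata h 0 p = 0 := by
    rw [objective_zero, (mem_solutionSet_iff r pdata).1 hp]
  -- The first step is exact and follows from the undamped inequality; the later ones are damped.
  rcases k with _ | k
  · have h1 := KL_exactStep_add_le r pdata h hT 0 p p0
    rw [hG, h0, mul_zero, add_zero] at h1
    rw [zero_add, iterate_one, iterate_zero]
    exact le_self_add.trans h1
  · have h1 := KL_exactStep_iterate_add_le r pdata h γ p0 0 hT p k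
    rw [hG, h0, mul_zero, mul_zero, add_zero] at h1
    exact le_self_add.trans h1

/-- The infimum times γK lies below the telescoped sum, hence below KL(p ‖ p^1) ≤ KL(p ‖ p^0). -/
theorem inf_KL_iterate_zero_le
    (hT : ∀ (p : ProbabilityMeasure X) y, corruptDensity r p y ≠ ∞) (hγ : 0 < γ)
    {p : ProbabilityMeasure X} (hp : p ∈ solutionSet r pdata) {K : ℕ} (hK : 1 ≤ K) :
    ((Finset.Icc 1 K).inf fun k =>
        KL (corrupt r pdata) (corrupt r (iterate r pdata h γ p0 0 k)))
      ≤ KL p p0 / ENNReal.ofReal ((γ : ℝ) * K) := by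
  have hG := exactStep_zero_of_mem r pdata h hT hp
  have h1 := sum_objective_iterate_le r pdata h γ p0 0 hT p K
  have hmono := KL_iterate_zero_succ_le r pdata h γ p0 hT hp 0
  rw [hG, ofReal_dataWeight_zero, objective_zero, (mem_solutionSet_iff r pdata).1 hp, mul_zero,
    mul_zero, mul_zero, add_zero] at h1
  have hγ' : (0 : ℝ) < γ := hγ
  have hK' : (0 : ℝ) < K := by exact_mod_cast hK
  rw [ENNReal.le_div_iff_mul_le (Or.inl (by simpa using mul_pos hγ' hK'))
    (Or.inl ENNReal.ofReal_ne_top), ENNReal.ofReal_mul hγ'.le, ENNReal.ofReal_natCast]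
  set I := (Finset.Icc 1 K).inf fun k =>
    KL (corrupt r pdata) (corrupt r (iterate r pdata h γ p0 0 k)) with hI
  calc I * (ENNReal.ofReal (γ : ℝ) * K)
      = ∑ k ∈ Finset.range K, ENNReal.ofReal (γ : ℝ) * (1 * I) := by
        rw [Finset.sum_const, Finset.card_range, nsmul_eq_mul]; ring
    _ ≤ ∑ k ∈ Finset.range K, ENNReal.ofReal (γ : ℝ) *
          (1 * objective r pdata h 0 (iterate r pdata h γ p0 0 (k + 1))) := by
        refine Finset.sum_le_sum fun k hk => ?_
        rw [objective_zero]
        gcongr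
        exact Finset.inf_le (f := fun k =>
          KL (corrupt r pdata) (corrupt r (iterate r pdata h γ p0 0 k)))
          (Finset.mem_Icc.2 ⟨Nat.le_add_left 1 k, Finset.mem_range.1 hk⟩)
    _ ≤ KL p p0 := (le_add_self.trans h1).trans hmono

end Unregularized

end SFBD

/-! ### Assembly of the proposition. -/

open SFBD in
theorem proposition5p1 {X Y : Type*}
    [TopologicalSpace X] [CompactSpace X] [TopologicalSpace.MetrizableSpace X]
    [MeasurableSpace X] [BorelSpace X]
    [MeasurableSpace Y] (ν : Measure Y) [SigmaFinite ν]
    (r : CorruptionDensity X Y ν) (hr : ∀ y, Continuous fun x => r.density x y)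
    (pdata h : ProbabilityMeasure X)
    (hsupp : (h : Measure X).IsOpenPosMeasure)
    (hfin : KL (corrupt r pdata) (corrupt r h) ≠ ∞)
    (γ : unitInterval) (hγ : 0 < γ) (p0 : ProbabilityMeasure X) :
    -- convergence to the optimum of the regularized problem
    (∀ lam : ℝ≥0, 0 < lam →
      (∃ p, IsMinimizer (objective r pdata h lam) Set.univ p) ∧
      (∀ p, IsMinimizer (objective r pdata h lam) Set.univ p →
        (p : Measure X) ≪ (h : Measure X) →
          IsArgmin (objective r pdata h lam) Set.univ p) ∧
      (∀ pstar, IsArgmin (objective r pdata h lam) Set.univ pstar →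
        Tendsto (fun k => iterate r pdata h γ p0 lam k) atTop (𝓝 pstar))) ∧
    -- the projection of the prior onto the solution set
    (∃ p, IsMinimizer (KL h) (solutionSet r pdata) p) ∧
    (∀ p, IsMinimizer (KL h) (solutionSet r pdata) p →
      KL h p ≠ ∞ → (p : Measure X) ≪ (h : Measure X) →
        IsArgmin (KL h) (solutionSet r pdata) p) ∧
    -- the limit of vanishing regularization
    (∀ hdag, IsArgmin (KL h) (solutionSet r pdata) hdag →
      (∀ pstar : ℝ≥0 → ProbabilityMeasure X,
        (∀ lam, 0 < lam → IsMinimizer (objective r pdata h lam) Set.univ (pstar lam)) →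
          Tendsto pstar (𝓝[>] 0) (𝓝 hdag)) ∧
      (∀ U ∈ 𝓝 hdag, ∀ᶠ lam in 𝓝[>] (0 : ℝ≥0), ∀ᶠ k in atTop,
        iterate r pdata h γ p0 lam k ∈ U)) ∧
    -- the iteration without regularization
    (∀ hdag, IsMinimizer (KL h) (solutionSet r pdata) hdag →
      (∀ k, KL hdag (iterate r pdata h γ p0 0 (k + 1)) ≤ KL hdag (iterate r pdata h γ p0 0 k)) ∧
      (∀ K : ℕ, 1 ≤ K →
        ((Finset.Icc 1 K).inf fun k =>
            KL (corrupt r pdata) (corrupt r (iterate r pdata h γ p0 0 k)))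
          ≤ KL hdag p0 / ENNReal.ofReal ((γ : ℝ) * K)) ∧
      (solutionSet r pdata = {hdag} → KL hdag p0 ≠ ∞ →
        Tendsto (fun k => iterate r pdata h γ p0 0 k) atTop (𝓝 hdag))) := by

  have hT := corruptDensity_ne_top r hr
  refine ⟨fun lam hlam => ⟨?_, fun p hp hac => ?_, fun pstar hpstar => ?_⟩, ?_, ?_, ?_, ?_⟩
  · exact exists_isMinimizer (lowerSemicontinuous_objective r hr pdata h lam) isClosed_univ
      ⟨h, Set.mem_univ h⟩
  · exact isArgmin_objective_of_absolutelyContinuous r pdata h hfin hlam hp hac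
  · refine tendsto_nhds.2 fun U hU hpU => ?_
    refine eventually_mem_of_isMinimizer_mem (lowerSemicontinuous_objective r hr pdata h lam) hU
      (fun b hb => ?_) fun p c hc =>
        eventually_objective_iterate_lt_of_pos r hr pdata h hsupp hfin hγ p0 hlam p hc
    rw [hpstar.2 b hb]
    exact hpU
  · exact exists_isMinimizer (lowerSemicontinuous_KL_right h) (isClosed_solutionSet r pdata hr)
      ⟨pdata, rfl⟩
  · exact fun p hp hpf hac => isArgmin_KL_of_absolutelyContinuous r pdata h hp hpf hac
  · refine fun hdag hdagmin => ⟨fun pstar hpstar => ?_, fun U hU => ?_⟩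
    · refine tendsto_nhds.2 fun U hU hdU => ?_
      filter_upwards [eventually_isMinimizer_mem r pdata h hr hfin hdagmin hU hdU,
        self_mem_nhdsWithin] with lam hlam hpos
      exact hlam _ (hpstar lam hpos)
    -- Minimizers of J_λ need not be unique here; it is enough that all of them lie in the interior
    -- of `U`.
    · filter_upwards [eventually_isMinimizer_mem r pdata h hr hfin hdagmin isOpen_interior
        (mem_interior_iff_mem_nhds.2 hU), self_mem_nhdsWithin] with lam hlam hpos
      refine (eventually_mem_of_isMinimizer_mem
        (lowerSemicontinuous_objective r hr pdata h lam) isOpen_interior hlam fun p c hc =>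
          eventually_objective_iterate_lt_of_pos r hr pdata h hsupp hfin hγ p0 hpos p hc).mono
        fun k hk => interior_subset hk
  · refine fun hdag hdagmin => ⟨fun k => ?_, fun K hK => ?_, fun hS hKL => ?_⟩
    · exact KL_iterate_zero_succ_le r pdata h γ p0 hT hdagmin.1 k
    · exact inf_KL_iterate_zero_le r pdata h γ p0 hT hγ hdagmin.1 hK
    · have h0 : objective r pdata h 0 hdag = 0 := by
        rw [objective_zero, (mem_solutionSet_iff r pdata).1 hdagmin.1]
      refine tendsto_nhds.2 fun U hU hdU => ?_
      refine eventually_mem_of_isMinimizer_mem (lowerSemicontinuous_objective r hr pdata h 0) hU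
        (fun b hb => ?_) fun p c hc => ?_
      · have h1 : b ∈ solutionSet r pdata := by
          rw [mem_solutionSet_iff, ← objective_zero r pdata h]
          exact le_antisymm ((hb.2 hdag (Set.mem_univ _)).trans_eq h0) zero_le
        rw [hS] at h1
        rw [Set.mem_singleton_iff.1 h1]
        exact hdU
      -- No approximation by bounded densities is needed: `hdag` is a fixed point, and its
      -- divergence from p^1 is at most the finite one from p^0.
      · refine eventually_objective_iterate_lt r pdata h γ p0 0 hT hγ hdag ?_
          (lt_of_le_of_lt (h0.le.trans zero_le) hc)
        rw [exactStep_zero_of_mem r pdata h hT hdagmin.1]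
        exact ne_top_of_le_ne_top hKL
          (KL_iterate_zero_succ_le r pdata h γ p0 hT hdagmin.1 0)
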